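/- Let $(M,g)$ be a connected smooth Riemannian manifold (without boundary) and let $\nabla$ be a smooth metric connection on $TM$ (that is, $\nabla g=0$) whose torsion is totally skew-symmetric: $T(X,Y,Z)=g(\nabla_XY-\nabla_YX-[X,Y],Z)$ is a $3$-form. Let $R(X,Y)Z=[\nabla_X,\nabla_Y]Z-\nabla_{[X,Y]}Z$ and $R(X,Y,Z,V)=g(R(X,Y)Z,V)$ be the curvature of $\nabla$. With respect to orthonormal bases $e_1,\dots,e_n$ of the tangent spaces put $Ric(X,Y)=\sum_i R(e_i,X,Y,e_i)$, $Scal=\sum_i Ric(e_i,e_i)$ and $\|T\|^2=\sum_{i,j,k}T(e_i,e_j,e_k)^2$. Suppose that $R\in S^2\Lambda^2$, i.e. $R(X,Y,Z,V)=R(Z,V,X,Y)$ for all $X,Y,Z,V$. Then the curvature of $\nabla$ satisfies the contracted Riemannian second Bianchi identity $$d(Scal)(X)-2\sum_{i}(\nabla_{e_i}Ric)(X,e_i)=0\qquad\text{for all }X$$ if and only if $\|T\|^2$ is constant on $M$. In particular, if moreover $\nabla$ is Ricci flat, $Ric=0$, then $\|T\|^2$ is constant on $M$. -/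

import Mathlib

open Bundle Manifold
open scoped ContDiff

noncomputable section

namespace SkewTorsion

variable {E : Type*} [NormedAddCommGroup E] [NormedSpace ℝ E] [FiniteDimensional ℝ E]
  {H : Type*} [TopologicalSpace H] {I : ModelWithCorners ℝ E H}
  {M : Type*} [TopologicalSpace M] [ChartedSpace H M]

instance tangentSpace_finiteDimensional (x : M) : FiniteDimensional ℝ (TangentSpace I x) :=
  inferInstanceAs (FiniteDimensional ℝ E)

section VectorFields

variable [IsManifold I 1 M]

/-- The local extension of a tangent vector `v` at `x` to a vector field on `M`: it has constant
components in the preferred chart at `x` (so it is smooth near `x`), and its value at `x` is `v`.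
Every tensor below is evaluated on tangent vectors through such extensions; by tensoriality any
other extension that is smooth near `x` gives the same value. -/
def ext {x : M} (v : TangentSpace I x) : Π y : M, TangentSpace I y :=
  FiberBundle.extend E v

/-- The curvature operator
`R(X, Y)Z = ∇_X ∇_Y Z - ∇_Y ∇_X Z - ∇_{[X, Y]} Z` of vector fields `X`, `Y`, `Z`
(recall that `nabla Z x (X x)` is `(∇_X Z)(x)`). -/
def curvatureField (nabla : CovariantDerivative I E (TangentSpace I : M → Type _))
    (X Y Z : Π y : M, TangentSpace I y) (x : M) : TangentSpace I x :=
  nabla (fun y ↦ nabla Z y (Y y)) x (X x) - nabla (fun y ↦ nabla Z y (X y)) x (Y x)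
    - nabla Z x (VectorField.mlieBracket I X Y x)

/-- The covariant derivative `(∇_w B)(u, v) = w(B(U, V)) - B(∇_w U, v) - B(u, ∇_w V)` of a
field `B` of bilinear forms on the tangent spaces, at tangent vectors `w, u, v` at `x`, where the
vector fields `U`, `V` extend `u`, `v`. -/
def covDerivBilin (nabla : CovariantDerivative I E (TangentSpace I : M → Type _))
    (B : Π y : M, TangentSpace I y → TangentSpace I y → ℝ) (x : M)
    (w u v : TangentSpace I x) : ℝ :=
  mvfderiv I (fun y ↦ B y (ext u y) (ext v y)) x w
    - B x (nabla (ext u) x w) v - B x u (nabla (ext v) x w)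

end VectorFields

section Riemannian

variable [RiemannianBundle (fun x : M ↦ TangentSpace I x)]

/-- An orthonormal basis of the tangent space at `x`. -/
def onb (I : ModelWithCorners ℝ E H) [RiemannianBundle (fun x : M ↦ TangentSpace I x)] (x : M) :
    OrthonormalBasis (Fin (Module.finrank ℝ (TangentSpace I x))) ℝ (TangentSpace I x) :=
  stdOrthonormalBasis ℝ (TangentSpace I x)

/-- The connection is metric, `∇g = 0`: for vector fields `Y`, `Z` differentiable at `x`,
`u(g(Y, Z)) = g(∇_u Y, Z) + g(Y, ∇_u Z)`. -/
def IsMetric [IsManifold I 1 M]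
    (nabla : CovariantDerivative I E (TangentSpace I : M → Type _)) : Prop :=
  ∀ (x : M) (Y Z : Π y : M, TangentSpace I y), MDiffAt (T% Y) x → MDiffAt (T% Z) x →
    ∀ u : TangentSpace I x,
      mvfderiv I (fun y ↦ inner ℝ (Y y) (Z y)) x u
        = inner ℝ (nabla Y x u) (Z x) + inner ℝ (Y x) (nabla Z x u)

section Torsion

variable [IsManifold I 2 M]

/-- The torsion as a tensor with three lower indices: `T(u, v, w) = g(T(u, v), w)`. -/
def torsionForm (nabla : CovariantDerivative I E (TangentSpace I : M → Type _)) (x : M)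
    (u v w : TangentSpace I x) : ℝ :=
  inner ℝ (nabla.torsion x u v) w

/-- The torsion is totally skew-symmetric, i.e. `torsionForm` is a 3-form. -/
def HasSkewTorsion (nabla : CovariantDerivative I E (TangentSpace I : M → Type _)) : Prop :=
  ∀ (x : M) (u v w : TangentSpace I x),
    torsionForm nabla x u v w = -torsionForm nabla x v u w ∧
    torsionForm nabla x u v w = -torsionForm nabla x u w v

/-- `‖T‖² = ∑ T(e_i, e_j, e_k)²`, the sum running over all indices `i, j, k`. -/
def torsionNormSq (nabla : CovariantDerivative I E (TangentSpace I : M → Type _)) (x : M) : ℝ :=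
  ∑ i, ∑ j, ∑ k, torsionForm nabla x (onb I x i) (onb I x j) (onb I x k) ^ 2

end Torsion

section Curvature

variable [IsManifold I 1 M]

/-- The curvature tensor `R(u, v, w, z) = g(R(u, v)w, z)`. -/
def curvature (nabla : CovariantDerivative I E (TangentSpace I : M → Type _)) (x : M)
    (u v w z : TangentSpace I x) : ℝ :=
  inner ℝ (curvatureField nabla (ext u) (ext v) (ext w) x) z

/-- `R ∈ S²Λ²`: the curvature is pair symmetric, `R(u, v, w, z) = R(w, z, u, v)`. -/
def CurvaturePairSymmetric
    (nabla : CovariantDerivative I E (TangentSpace I : M → Type _)) : Prop :=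
  ∀ (x : M) (u v w z : TangentSpace I x),
    curvature nabla x u v w z = curvature nabla x w z u v

/-- The Ricci tensor `Ric(u, v) = ∑ R(e_i, u, v, e_i)`. -/
def ricci (nabla : CovariantDerivative I E (TangentSpace I : M → Type _)) (x : M)
    (u v : TangentSpace I x) : ℝ :=
  ∑ i, curvature nabla x (onb I x i) u v (onb I x i)

/-- The scalar curvature `Scal = ∑ Ric(e_i, e_i)`. -/
def scal (nabla : CovariantDerivative I E (TangentSpace I : M → Type _)) (x : M) : ℝ :=
  ∑ i, ricci nabla x (onb I x i) (onb I x i)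

/-- The contracted Riemannian second Bianchi identity
`d(Scal)(u) - 2 ∑ (∇_{e_i} Ric)(u, e_i) = 0`. -/
def ContractedSecondBianchi
    (nabla : CovariantDerivative I E (TangentSpace I : M → Type _)) : Prop :=
  ∀ (x : M) (u : TangentSpace I x),
    mvfderiv I (scal nabla) x u
      - 2 * ∑ i, covDerivBilin nabla (ricci nabla) x (onb I x i) u (onb I x i) = 0

/-- The connection is Ricci flat: `Ric = 0`. -/
def RicciFlat (nabla : CovariantDerivative I E (TangentSpace I : M → Type _)) : Prop :=
  ∀ (x : M) (u v : TangentSpace I x), ricci nabla x u v = 0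

end Curvature

end Riemannian

end SkewTorsion

end

/-! The theorem follows from a pointwise formula, `OrthonormalFrameNear.mvfderiv_scal_sub`:
d(Scal)(u) - 2 ∑ (∇_{e_i} Ric)(u, e_i) = -(1/2) u(‖T‖²). The contracted identity thus says exactly
that ‖T‖² has zero differential, and on a connected manifold without boundary this means that it is
constant.

Write σ for the cyclic sum over X, Y, Z. The first Bianchi identity with skew torsion reads σ
R(X,Y,Z,V) = σ [(∇_X T)(Y,Z,V) + g(T(X,Y), T(Z,V))]. Under pair symmetry the curvature sum and the
quadratic term both change sign when X and V are exchanged, so ∇T is totally skew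
(`covDerivTorsion_skew`). Contracting the identity with T kills the quadratic term
(`sum_mul_torsionForm_torsion`) and leaves ∑ T(e_i,e_j,e_k) R(e_i,e_j,e_k,u) = -⟨T, ∇_u T⟩ = -(1/2)
u(‖T‖²).

The second Bianchi identity (`secondBianchi`) reads σ [(∇_X R)(Y,Z,W,V) + R(T(X,Y),Z,W,V)] = 0.
Traced twice, its derivative terms become 2 div Ric - d(Scal). Two torsion terms pair the skew T
with the symmetric Ricci tensor and vanish; the third is the sum above.

The tensors are evaluated through chart extensions and through orthonormal bases chosen separately
at each point. Tensoriality (`eq_of_tensorial`) frees them from the extensions; smooth orthonormal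
frames (`exists_orthonormalFrameNear`) and basis independence of traces make them differentiable.
The connection matrix of such a frame is skew, so derivatives of the frame drop out of every trace.
-/

noncomputable section

namespace SkewTorsion

open Filter Topology VectorField

/-! ### Regularity instances for Lie brackets over the reals -/

section MinSmoothness

variable {E : Type*} [NormedAddCommGroup E] [NormedSpace ℝ E]
  {H : Type*} [TopologicalSpace H] {I : ModelWithCorners ℝ E H}
  {M : Type*} [TopologicalSpace M] [ChartedSpace H M] [IsManifold I ∞ M]

lemma isManifold_minSmoothness_two : IsManifold I (minSmoothness ℝ 2) M := by
  simpa using! (inferInstance : IsManifold I 2 M)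

lemma isManifold_minSmoothness_three : IsManifold I (minSmoothness ℝ 3) M := by
  simpa using! (inferInstance : IsManifold I 3 M)

end MinSmoothness

attribute [local instance] isManifold_minSmoothness_two isManifold_minSmoothness_three

/-! ### Germs of smooth functions and vector fields -/

section Smooth

variable {E : Type*} [NormedAddCommGroup E] [NormedSpace ℝ E]
  {H : Type*} [TopologicalSpace H] {I : ModelWithCorners ℝ E H}
  {M : Type*} [TopologicalSpace M] [ChartedSpace H M]

variable (I) in
/-- The function `f` is smooth on a neighbourhood of `x`. -/
def SmoothFunNear (x : M) (f : M → ℝ) : Prop :=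
  ∀ᶠ y in 𝓝 x, CMDiffAt ∞ f y

namespace SmoothFunNear

variable {x : M} {f g : M → ℝ}

lemma contMDiffAt (hf : SmoothFunNear I x f) : CMDiffAt ∞ f x := hf.self_of_nhds

lemma mdifferentiableAt (hf : SmoothFunNear I x f) : MDiffAt f x :=
  hf.contMDiffAt.mdifferentiableAt (by simp)

lemma eventually (hf : SmoothFunNear I x f) : ∀ᶠ y in 𝓝 x, SmoothFunNear I y f :=
  eventually_eventually_nhds.2 hf

lemma const (c : ℝ) : SmoothFunNear I x (fun _ ↦ c) := .of_forall fun _ ↦ contMDiffAt_const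

lemma mul (hf : SmoothFunNear I x f) (hg : SmoothFunNear I x g) : SmoothFunNear I x (f * g) := by
  filter_upwards [hf, hg] with y h1 h2 using h1.mul h2

lemma inv₀ (hf : SmoothFunNear I x f) (h : f x ≠ 0) : SmoothFunNear I x (f⁻¹) := by
  filter_upwards [hf, hf.contMDiffAt.continuousAt.eventually_ne h] with y h1 h2 using h1.inv₀ h2

lemma sqrt (hf : SmoothFunNear I x f) (h : f x ≠ 0) :
    SmoothFunNear I x (fun y ↦ Real.sqrt (f y)) := by
  filter_upwards [hf, hf.contMDiffAt.continuousAt.eventually_ne h] with y h1 h2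
  exact (Real.contDiffAt_sqrt h2).contMDiffAt.comp y h1

lemma congr (hf : SmoothFunNear I x f) (h : g =ᶠ[𝓝 x] f) : SmoothFunNear I x g := by
  filter_upwards [hf, h.eventuallyEq_nhds] with y h1 h2 using h1.congr_of_eventuallyEq h2

end SmoothFunNear

variable [IsManifold I ∞ M] {x : M} {X Y Z : Π y : M, TangentSpace I y} {f g : M → ℝ}

/-- The vector field `X` is smooth on a neighbourhood of `x`. -/
def SmoothNear (x : M) (X : Π y : M, TangentSpace I y) : Prop :=
  ∀ᶠ y in 𝓝 x, CMDiffAt ∞ (T% X) y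

namespace SmoothNear

lemma contMDiffAt (hX : SmoothNear x X) : CMDiffAt ∞ (T% X) x := hX.self_of_nhds

lemma mdifferentiableAt (hX : SmoothNear x X) : MDiffAt (T% X) x :=
  hX.contMDiffAt.mdifferentiableAt (by simp)

lemma eventually (hX : SmoothNear x X) : ∀ᶠ y in 𝓝 x, SmoothNear y X :=
  eventually_eventually_nhds.2 hX

lemma add (hX : SmoothNear x X) (hY : SmoothNear x Y) : SmoothNear x (X + Y) := by
  filter_upwards [hX, hY] with y h1 h2 using h1.add_section h2

lemma sub (hX : SmoothNear x X) (hY : SmoothNear x Y) : SmoothNear x (X - Y) := by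
  filter_upwards [hX, hY] with y h1 h2 using h1.sub_section h2

lemma smul (hf : SmoothFunNear I x f) (hX : SmoothNear x X) : SmoothNear x (f • X) := by
  filter_upwards [hf, hX] with y h1 h2 using h1.smul_section h2

lemma sum {ι : Type*} {s : Finset ι} {F : ι → Π y : M, TangentSpace I y}
    (hF : ∀ i ∈ s, SmoothNear x (F i)) : SmoothNear x (fun y ↦ ∑ i ∈ s, F i y) := by
  have : ∀ᶠ y in 𝓝 x, ∀ i ∈ s, CMDiffAt ∞ (T% (F i)) y :=
    (Finset.eventually_all s).2 hF
  filter_upwards [this] with y h using ContMDiffAt.sum_section h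

lemma congr (hX : SmoothNear x X) (h : ∀ᶠ y in 𝓝 x, Y y = X y) : SmoothNear x Y := by
  filter_upwards [hX, h.eventually_nhds] with y h1 h2
  exact h1.congr_of_eventuallyEq (h2.mono fun z hz ↦ by simp [hz])

lemma ext [FiniteDimensional ℝ E] (v : TangentSpace I x) : SmoothNear x (ext v) := by
  have h : CMDiffAt ∞ (T% (SkewTorsion.ext v)) x := FiberBundle.contMDiffAt_extend I E v
  obtain ⟨s, hs, h⟩ := FiberBundle.exists_contMDiffOn_extend (k := ∞) I E v
  filter_upwards [eventually_mem_nhds_iff.2 hs] with y hy using h.contMDiffAt hy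

lemma mlieBracket [CompleteSpace E] (hX : SmoothNear x X) (hY : SmoothNear x Y) :
    SmoothNear x (VectorField.mlieBracket I X Y) := by
  filter_upwards [hX, hY] with y h1 h2
  have : IsManifold I (((⊤ : ℕ∞) : ℕ∞ω) + 1) M := by
    simpa using! (inferInstance : IsManifold I ∞ M)
  exact ContMDiffAt.mlieBracket_vectorField (n := ⊤) (m := ⊤) h1 h2 (by simp)

lemma inner [RiemannianBundle (fun x : M ↦ TangentSpace I x)]
    [IsContMDiffRiemannianBundle I ∞ E (fun x : M ↦ TangentSpace I x)]
    (hX : SmoothNear x X) (hY : SmoothNear x Y) :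
    SmoothFunNear I x (fun y ↦ inner ℝ (X y) (Y y)) := by
  filter_upwards [hX, hY] with y h1 h2
  exact ContMDiffAt.inner_bundle (E := fun y : M ↦ TangentSpace I y) (b := fun y ↦ y) h1 h2

variable [FiniteDimensional ℝ E] [T2Space M]

/-- A vector field which is smooth near `x` agrees near `x` with a globally smooth one. -/
lemma exists_contMDiff (hX : SmoothNear x X) :
    ∃ Y : Π y : M, TangentSpace I y, CMDiff ∞ (T% Y) ∧ ∀ᶠ y in 𝓝 x, Y y = X y := by
  obtain ⟨u, hu, huo, hxu⟩ := eventually_nhds_iff.1 hX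
  -- A bump function supported where `X` is smooth turns the germ into a global field.
  obtain ⟨χ, -, hχ⟩ := (SmoothBumpFunction.nhds_basis_tsupport (I := I) x).mem_iff.1
    (huo.mem_nhds hxu)
  refine ⟨(χ : M → ℝ) • X, ?_, ?_⟩
  · exact ContMDiffOn.smul_section_of_tsupport χ.contMDiff.contMDiffOn huo hχ
      fun y hy ↦ (hu y hy).contMDiffWithinAt
  · filter_upwards [χ.eventuallyEq_one] with y hy
    simp [hy]

/-- Smoothness of the connection is a statement about globally smooth sections, so the germ of `Y`
is first replaced by a global field; locality of `nabla` carries the result back. -/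
lemma covDeriv {nabla : CovariantDerivative I E (TangentSpace I : M → Type _)}
    (hn : nabla.ContMDiffCovariantDerivative ∞) (hX : SmoothNear x X) (hY : SmoothNear x Y) :
    SmoothNear x (fun y ↦ nabla Y y (X y)) := by
  obtain ⟨Y', hY', h⟩ := hY.exists_contMDiff
  have key := hn.contMDiff.contMDiff (σ := Y') (by simpa using! hY'.contMDiffOn)
  filter_upwards [hX, hY.eventually, h.eventually_nhds] with y h1 h2 h3
  have h4 := (key y (Set.mem_univ _)).contMDiffAt Filter.univ_mem
  have h5 := ContMDiffAt.clm_bundle_apply h4 h1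
  refine h5.congr_of_eventuallyEq ?_
  filter_upwards [h2.eventually, h3.eventually_nhds] with z h6 h7
  have : nabla Y z = nabla Y' z :=
    nabla.isCovariantDerivativeOn.congr_of_eventuallyEq h6.mdifferentiableAt
      (h6.congr h7).mdifferentiableAt Filter.univ_mem (h7.mono fun _ h ↦ h.symm)
  simp only [this]

end SmoothNear

end Smooth

/-! ### Directional derivatives, Lie brackets and tensoriality -/

section Derivations

variable {E : Type*} [NormedAddCommGroup E] [NormedSpace ℝ E] [FiniteDimensional ℝ E]
  {H : Type*} [TopologicalSpace H] {I : ModelWithCorners ℝ E H}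
  {M : Type*} [TopologicalSpace M] [ChartedSpace H M] [IsManifold I ∞ M]
  {x : M} {X Y Z : Π y : M, TangentSpace I y} {f g : M → ℝ}

omit [FiniteDimensional ℝ E] [IsManifold I ∞ M] in
lemma mvfderiv_congr (h : f =ᶠ[𝓝 x] g) : mvfderiv I f x = mvfderiv I g x := by
  ext v
  simp only [mvfderiv, h.mfderiv_eq]
  rfl

omit [FiniteDimensional ℝ E] in
@[simp] lemma ext_self (v : TangentSpace I x) : ext v x = v := FiberBundle.extend_apply_self ..

section Metric

variable [RiemannianBundle (fun x : M ↦ TangentSpace I x)]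
  [IsContMDiffRiemannianBundle I ∞ E (fun x : M ↦ TangentSpace I x)]

/-- Since [X, fZ] - f[X, Z] = (Xf) Z, pairing with a field Z that does not vanish near `x` and
dividing by |Z|² expresses Xf through smooth quantities. In dimension zero there is no such Z, but
every derivative is zero. -/
lemma SmoothFunNear.deriv (hf : SmoothFunNear I x f) (hX : SmoothNear x X) :
    SmoothFunNear I x (fun y ↦ mvfderiv I f y (X y)) := by
  rcases subsingleton_or_nontrivial E with h | h
  · refine (SmoothFunNear.const 0).congr (.of_forall fun y ↦ ?_)
    have : Subsingleton (TangentSpace I y) := h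
    simp [Subsingleton.elim (X y) 0]
  obtain ⟨e, he⟩ := exists_ne (0 : E)
  let Z : Π y : M, TangentSpace I y := ext (x := x) e
  have hZ : SmoothNear x Z := .ext _
  have hZx : Z x ≠ 0 := (ext_self (I := I) (x := x) e).trans_ne he
  have h0 : (fun y ↦ inner ℝ (Z y) (Z y) : M → ℝ) x ≠ 0 := by simpa using hZx
  refine ((((hX.mlieBracket (.smul hf hZ)).sub (.smul hf (hX.mlieBracket hZ))).inner hZ).mul
    ((hZ.inner hZ).inv₀ h0)).congr ?_
  filter_upwards [hf.eventually, hZ.eventually,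
    (hZ.inner hZ).contMDiffAt.continuousAt.eventually_ne h0] with y h1 h2 h3
  have := mlieBracket_smul_right (V := X) h1.mdifferentiableAt h2.mdifferentiableAt
  simp only [Pi.mul_apply, Pi.sub_apply, this, Pi.smul_apply', add_sub_cancel_right, Pi.inv_apply,
    inner_smul_left]
  field_simp
  simp

/-- Compare the Jacobi identity for X, Y, fZ with the one for X, Y, Z, where Z(x) ≠ 0: the
difference is a multiple of Z(x), and its coefficient is the claim. -/
lemma mvfderiv_mlieBracket (hf : SmoothFunNear I x f) (hX : SmoothNear x X)
    (hY : SmoothNear x Y) :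
    mvfderiv I f x (mlieBracket I X Y x)
      = mvfderiv I (fun y ↦ mvfderiv I f y (Y y)) x (X x)
        - mvfderiv I (fun y ↦ mvfderiv I f y (X y)) x (Y x) := by
  rcases subsingleton_or_nontrivial E with h | h
  · have : Subsingleton (TangentSpace I x) := h
    simp [Subsingleton.elim (X x) 0, Subsingleton.elim (Y x) 0,
      Subsingleton.elim (mlieBracket I X Y x) 0]
  obtain ⟨e, he⟩ := exists_ne (0 : E)
  let Z : Π y : M, TangentSpace I y := ext (x := x) e
  have hZ : SmoothNear x Z := .ext _
  have hZx : Z x ≠ 0 := (ext_self (I := I) (x := x) e).trans_ne he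
  have h2 : (minSmoothness ℝ 2) ≤ ∞ := by simpa using! ENat.LEInfty.out (m := 2)
  have key := leibniz_identity_mlieBracket_apply (hX.contMDiffAt.of_le h2)
    (hY.contMDiffAt.of_le h2) ((SmoothNear.smul hf hZ).contMDiffAt.of_le h2)
  have key' := leibniz_identity_mlieBracket_apply (hX.contMDiffAt.of_le h2)
    (hY.contMDiffAt.of_le h2) (hZ.contMDiffAt.of_le h2)
  have expand : ∀ X Y : Π y : M, TangentSpace I y, SmoothNear x X → SmoothNear x Y →
      mlieBracket I X (mlieBracket I Y (f • Z)) x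
        = mvfderiv I (fun y ↦ mvfderiv I f y (Y y)) x (X x) • Z x
          + mvfderiv I f x (Y x) • mlieBracket I X Z x
          + mvfderiv I f x (X x) • mlieBracket I Y Z x
          + f x • mlieBracket I X (mlieBracket I Y Z) x := by
    intro X Y hX hY
    have h : mlieBracket I Y (f • Z) =ᶠ[𝓝 x]
        (fun y ↦ mvfderiv I f y (Y y)) • Z + f • mlieBracket I Y Z := by
      filter_upwards [hf.eventually, hZ.eventually] with y h1 h2
      exact mlieBracket_smul_right h1.mdifferentiableAt h2.mdifferentiableAt
    have hd := hf.deriv hY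
    rw [(EventuallyEq.refl _ X).mlieBracket_vectorField_eq h,
      mlieBracket_add_right (SmoothNear.smul hd hZ).mdifferentiableAt
        (SmoothNear.smul hf (hY.mlieBracket hZ)).mdifferentiableAt,
      mlieBracket_smul_right hd.mdifferentiableAt hZ.mdifferentiableAt,
      mlieBracket_smul_right hf.mdifferentiableAt (hY.mlieBracket hZ).mdifferentiableAt]
    abel
  rw [expand X Y hX hY, expand Y X hY hX,
    mlieBracket_smul_right hf.mdifferentiableAt hZ.mdifferentiableAt, key'] at key
  have : (mvfderiv I f x (mlieBracket I X Y x)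
      - (mvfderiv I (fun y ↦ mvfderiv I f y (Y y)) x (X x)
        - mvfderiv I (fun y ↦ mvfderiv I f y (X y)) x (Y x))) • Z x = 0 := by
    rw [← sub_eq_zero] at key
    rw [← neg_eq_zero, ← key]
    module
  exact sub_eq_zero.1 ((smul_eq_zero.1 this).resolve_right hZx)

end Metric

section Tensorial

variable {A : Type*} [AddCommGroup A] [Module ℝ A]

/-- An operation on vector fields which is additive and linear over germs of smooth functions only
depends on the value of the field, among fields that are smooth near the point. -/
lemma eq_of_tensorial {Φ : (Π y : M, TangentSpace I y) → A}
    (smul : ∀ f X, SmoothFunNear I x f → SmoothNear x X → Φ (f • X) = f x • Φ X)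
    (add : ∀ X Y, SmoothNear x X → SmoothNear x Y → Φ (X + Y) = Φ X + Φ Y)
    (hX : SmoothNear x X) (hY : SmoothNear x Y) (h : X x = Y x) : Φ X = Φ Y := by
  classical
  have hloc : ∀ {X Y : Π y : M, TangentSpace I y}, SmoothNear x X → SmoothNear x Y →
      (∀ᶠ y in 𝓝 x, X y = Y y) → Φ X = Φ Y := by
    intro X Y hX hY hXY
    -- The indicator of {X = Y} equals 1 near `x`, hence is smooth there, and ψX = ψY holds
    -- everywhere. So Φ depends only on germs.
    let ψ : M → ℝ := fun y ↦ if X y = Y y then 1 else 0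
    have hψ : SmoothFunNear I x ψ :=
      (SmoothFunNear.const 1).congr (hXY.mono fun y hy ↦ by simp [ψ, hy])
    have hψx : ψ x = 1 := by simp [ψ, hXY.self_of_nhds]
    have : ψ • X = ψ • Y := by
      funext y
      by_cases hy : X y = Y y <;> simp [ψ, hy]
    simpa [smul _ _ hψ hX, smul _ _ hψ hY, hψx] using congrArg Φ this
  have zero : Φ 0 = 0 := by
    have h0 : SmoothNear x (0 : Π y : M, TangentSpace I y) := by
      simpa using (SmoothNear.ext (I := I) (x := x) 0).sub (.ext 0)
    simpa using smul 0 0 (.const 0) h0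
  have sum : ∀ {ι : Type _} (s : Finset ι) (F : ι → Π y : M, TangentSpace I y),
      (∀ i ∈ s, SmoothNear x (F i)) → Φ (fun y ↦ ∑ i ∈ s, F i y) = ∑ i ∈ s, Φ (F i) := by
    intro ι s F
    induction s using Finset.induction_on with
    | empty => intro _; simpa using! zero
    | insert a s ha ih =>
      intro hF
      simp only [Finset.sum_insert ha]
      rw [← ih fun i hi ↦ hF i (Finset.mem_insert_of_mem hi),
        ← add _ _ (hF a (Finset.mem_insert_self ..))
          (.sum fun i hi ↦ hF i (Finset.mem_insert_of_mem hi))]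
      rfl
  let t := trivializationAt E (TangentSpace I : M → Type _) x
  have hx : x ∈ t.baseSet := FiberBundle.mem_baseSet_trivializationAt E _ x
  let b := Module.finBasis ℝ E
  let c := t.localFrameCoeff I b
  have hs : ∀ i, SmoothNear x (t.localFrame b i) := fun i ↦ by
    filter_upwards [t.open_baseSet.mem_nhds hx] with y hy
    exact contMDiffAt_localFrame_of_mem ∞ t b i hy
  have hc : ∀ {X : Π y : M, TangentSpace I y}, SmoothNear x X → ∀ i,
      SmoothFunNear I x (LinearMap.piApply (c i) X) := fun hX i ↦ by
    filter_upwards [t.open_baseSet.mem_nhds hx, hX] with y hy h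
    exact contMDiffAt_localFrameCoeff b hy h i
  -- In a local frame, Φ X is determined by the coefficients of `X` at the single point `x`.
  have expand : ∀ {X : Π y : M, TangentSpace I y}, SmoothNear x X →
      Φ X = ∑ i, c i x (X x) • Φ (t.localFrame b i) := by
    intro X hX
    have h1 : ∀ i ∈ Finset.univ,
        SmoothNear x ((LinearMap.piApply (c i) X : M → ℝ) • t.localFrame b i) :=
      fun i _ ↦ .smul (hc hX i) (hs i)
    rw [hloc hX (SmoothNear.sum h1) (t.eventually_eq_localFrame_sum_coeff_smul b hx), sum _ _ h1]
    exact Finset.sum_congr rfl fun i _ ↦ smul _ _ (hc hX i) (hs i)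
  rw [expand hX, expand hY, h]

end Tensorial

end Derivations

/-! ### Tensoriality of the curvature -/

section Curvature

variable {E : Type*} [NormedAddCommGroup E] [NormedSpace ℝ E] [FiniteDimensional ℝ E]
  {H : Type*} [TopologicalSpace H] {I : ModelWithCorners ℝ E H}
  {M : Type*} [TopologicalSpace M] [ChartedSpace H M] [IsManifold I ∞ M]
  {x : M} {X X' Y Y' Z Z' : Π y : M, TangentSpace I y} {f g : M → ℝ}
  {nabla : CovariantDerivative I E (TangentSpace I : M → Type _)}

omit [FiniteDimensional ℝ E] in
lemma covDeriv_congr (hX : SmoothNear x X) (h : ∀ᶠ y in 𝓝 x, Y y = X y) :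
    nabla Y x = nabla X x :=
  nabla.isCovariantDerivativeOn.congr_of_eventuallyEq (hX.congr h).mdifferentiableAt
    hX.mdifferentiableAt Filter.univ_mem h

omit [FiniteDimensional ℝ E] in
lemma covDeriv_add (hX : SmoothNear x X) (hY : SmoothNear x Y) :
    nabla (X + Y) x = nabla X x + nabla Y x :=
  nabla.isCovariantDerivativeOn.add (s := Set.univ) hX.mdifferentiableAt hY.mdifferentiableAt

omit [FiniteDimensional ℝ E] in
lemma covDeriv_smul (hf : SmoothFunNear I x f) (hX : SmoothNear x X) (v : TangentSpace I x) :
    nabla (f • X) x v = f x • nabla X x v + mvfderiv I f x v • X x := by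
  rw [nabla.isCovariantDerivativeOn.leibniz (s := Set.univ) hX.mdifferentiableAt
    hf.mdifferentiableAt]
  rfl

omit [FiniteDimensional ℝ E] in
lemma covDeriv_sub (hX : SmoothNear x X) (hY : SmoothNear x Y) :
    nabla (X - Y) x = nabla X x - nabla Y x := by
  have := covDeriv_add (nabla := nabla) (hX.sub hY) hY
  rw [sub_add_cancel] at this
  rw [this, add_sub_cancel_right]

omit [FiniteDimensional ℝ E] in
lemma curvatureField_swap : curvatureField nabla X Y Z x = -curvatureField nabla Y X Z x := by
  simp only [curvatureField]
  rw [mlieBracket_swap_apply, map_neg]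
  abel

variable [T2Space M] (hn : nabla.ContMDiffCovariantDerivative ∞)
include hn

lemma SmoothNear.curvatureField (hX : SmoothNear x X) (hY : SmoothNear x Y)
    (hZ : SmoothNear x Z) : SmoothNear x (curvatureField nabla X Y Z) :=
  ((SmoothNear.covDeriv hn hX (.covDeriv hn hY hZ)).sub
    (.covDeriv hn hY (.covDeriv hn hX hZ))).sub (.covDeriv hn (hX.mlieBracket hY) hZ)

lemma curvatureField_add_left (hX : SmoothNear x X) (hX' : SmoothNear x X')
    (hZ : SmoothNear x Z) :
    curvatureField nabla (X + X') Y Z x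
      = curvatureField nabla X Y Z x + curvatureField nabla X' Y Z x := by
  have h1 : nabla (fun y ↦ nabla Z y ((X + X') y)) x (Y x)
      = nabla (fun y ↦ nabla Z y (X y)) x (Y x) + nabla (fun y ↦ nabla Z y (X' y)) x (Y x) := by
    rw [show (fun y ↦ nabla Z y ((X + X') y))
      = (fun y ↦ nabla Z y (X y)) + fun y ↦ nabla Z y (X' y) by ext y; simp,
      covDeriv_add (SmoothNear.covDeriv hn hX hZ) (SmoothNear.covDeriv hn hX' hZ)]
    rfl
  rw [curvatureField, h1, mlieBracket_add_left hX.mdifferentiableAt hX'.mdifferentiableAt,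
    Pi.add_apply, map_add, map_add, curvatureField, curvatureField]
  abel

lemma curvatureField_smul_left (hf : SmoothFunNear I x f) (hX : SmoothNear x X)
    (hZ : SmoothNear x Z) :
    curvatureField nabla (f • X) Y Z x = f x • curvatureField nabla X Y Z x := by
  have h1 : nabla (fun y ↦ nabla Z y ((f • X) y)) x (Y x)
      = f x • nabla (fun y ↦ nabla Z y (X y)) x (Y x) + mvfderiv I f x (Y x) • nabla Z x (X x) := by
    rw [show (fun y ↦ nabla Z y ((f • X) y)) = f • fun y ↦ nabla Z y (X y) by ext y; simp,
      covDeriv_smul hf (SmoothNear.covDeriv hn hX hZ)]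
  rw [curvatureField, h1, mlieBracket_smul_left hf.mdifferentiableAt hX.mdifferentiableAt,
    Pi.smul_apply', map_add, map_smul, map_smul, map_smul, curvatureField]
  module

lemma curvatureField_add_right (hX : SmoothNear x X) (hY : SmoothNear x Y)
    (hZ : SmoothNear x Z) (hZ' : SmoothNear x Z') :
    curvatureField nabla X Y (Z + Z') x
      = curvatureField nabla X Y Z x + curvatureField nabla X Y Z' x := by
  have key : ∀ X Y : Π y : M, TangentSpace I y, SmoothNear x X → SmoothNear x Y →
      nabla (fun y ↦ nabla (Z + Z') y (Y y)) x (X x) =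
        nabla (fun y ↦ nabla Z y (Y y)) x (X x) + nabla (fun y ↦ nabla Z' y (Y y)) x (X x) := by
    intro X Y hX hY
    have h : ∀ᶠ y in 𝓝 x, nabla (Z + Z') y (Y y)
        = ((fun y ↦ nabla Z y (Y y)) + fun y ↦ nabla Z' y (Y y)) y := by
      filter_upwards [hZ.eventually, hZ'.eventually] with y h1 h2
      rw [covDeriv_add h1 h2]; rfl
    have h1 := SmoothNear.covDeriv hn hY hZ
    have h2 := SmoothNear.covDeriv hn hY hZ'
    rw [covDeriv_congr (h1.add h2) h, covDeriv_add h1 h2]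
    rfl
  simp only [curvatureField, key X Y hX hY, key Y X hY hX, covDeriv_add hZ hZ',
    add_apply]
  abel

variable [RiemannianBundle (fun x : M ↦ TangentSpace I x)]
  [IsContMDiffRiemannianBundle I ∞ E (fun x : M ↦ TangentSpace I x)]

/-- The mixed first-order terms are symmetric in X, Y and cancel; the second derivatives of f cancel
against [X, Y]f by `mvfderiv_mlieBracket`. -/
lemma curvatureField_smul_right (hf : SmoothFunNear I x f) (hX : SmoothNear x X)
    (hY : SmoothNear x Y) (hZ : SmoothNear x Z) :
    curvatureField nabla X Y (f • Z) x = f x • curvatureField nabla X Y Z x := by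
  have key : ∀ X Y : Π y : M, TangentSpace I y, SmoothNear x X → SmoothNear x Y →
      nabla (fun y ↦ nabla (f • Z) y (Y y)) x (X x) =
        f x • nabla (fun y ↦ nabla Z y (Y y)) x (X x)
        + mvfderiv I f x (X x) • nabla Z x (Y x) + mvfderiv I f x (Y x) • nabla Z x (X x)
        + mvfderiv I (fun y ↦ mvfderiv I f y (Y y)) x (X x) • Z x := by
    intro X Y hX hY
    have h : ∀ᶠ y in 𝓝 x, nabla (f • Z) y (Y y)
        = (f • (fun y ↦ nabla Z y (Y y)) + (fun y ↦ mvfderiv I f y (Y y)) • Z) y := by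
      filter_upwards [hf.eventually, hZ.eventually] with y h1 h2
      rw [covDeriv_smul h1 h2]; rfl
    have h1 := SmoothNear.covDeriv hn hY hZ
    have h2 := SmoothNear.smul (hf.deriv hY) hZ
    rw [covDeriv_congr ((SmoothNear.smul hf h1).add h2) h, covDeriv_add (.smul hf h1) h2,
      add_apply, covDeriv_smul hf h1, covDeriv_smul (hf.deriv hY) hZ]
    abel
  simp only [curvatureField, key X Y hX hY, key Y X hY hX, covDeriv_smul hf hZ,
    mvfderiv_mlieBracket hf hX hY]
  module

lemma curvatureField_congr (hX : SmoothNear x X) (hY : SmoothNear x Y) (hZ : SmoothNear x Z)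
    (hX' : SmoothNear x X') (hY' : SmoothNear x Y') (hZ' : SmoothNear x Z')
    (h1 : X x = X' x) (h2 : Y x = Y' x) (h3 : Z x = Z' x) :
    curvatureField nabla X Y Z x = curvatureField nabla X' Y' Z' x := by
  have left : ∀ {X X' Y : Π y : M, TangentSpace I y}, SmoothNear x X → SmoothNear x X' →
      X x = X' x → curvatureField nabla X Y Z x = curvatureField nabla X' Y Z x :=
    fun {X X' Y} hX hX' h ↦ eq_of_tensorial (Φ := fun X ↦ curvatureField nabla X Y Z x)
      (fun f X hf hX ↦ curvatureField_smul_left hn hf hX hZ)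
      (fun X X' hX hX' ↦ curvatureField_add_left hn hX hX' hZ) hX hX' h
  rw [left hX hX' h1, curvatureField_swap, left hY hY' h2, ← curvatureField_swap]
  exact eq_of_tensorial (Φ := fun Z ↦ curvatureField nabla X' Y' Z x)
      (fun f Z hf hZ ↦ curvatureField_smul_right hn hf hX' hY' hZ)
      (fun Z Z' hZ hZ' ↦ curvatureField_add_right hn hX' hY' hZ hZ') hZ hZ' h3

/-- Frees the curvature tensor from the chart extensions in its definition, so that it can be
differentiated along arbitrary smooth fields. -/
lemma curvature_eq_inner (hX : SmoothNear x X) (hY : SmoothNear x Y) (hZ : SmoothNear x Z)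
    (w : TangentSpace I x) :
    curvature nabla x (X x) (Y x) (Z x) w = inner ℝ (curvatureField nabla X Y Z x) w := by
  rw [curvature, curvatureField_congr hn (.ext _) (.ext _) (.ext _) hX hY hZ] <;> simp

lemma SmoothNear.curvature {W : Π y : M, TangentSpace I y} (hX : SmoothNear x X)
    (hY : SmoothNear x Y) (hZ : SmoothNear x Z) (hW : SmoothNear x W) :
    SmoothFunNear I x (fun y ↦ curvature nabla y (X y) (Y y) (Z y) (W y)) := by
  refine ((SmoothNear.curvatureField hn hX hY hZ).inner hW).congr ?_
  filter_upwards [hX.eventually, hY.eventually, hZ.eventually] with y h1 h2 h3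
  exact curvature_eq_inner hn h1 h2 h3 _

omit hn [T2Space M] [IsContMDiffRiemannianBundle I ∞ E (fun x : M ↦ TangentSpace I x)]
  [FiniteDimensional ℝ E] in
lemma curvature_swap (u v w z : TangentSpace I x) :
    curvature nabla x u v w z = -curvature nabla x v u w z := by
  rw [curvature, curvatureField_swap, inner_neg_left, curvature]

lemma isLinearMap_curvature₁ (v w z : TangentSpace I x) :
    IsLinearMap ℝ (fun u ↦ curvature nabla x u v w z) where
  map_add u u' := by
    have h := curvature_eq_inner hn ((SmoothNear.ext u).add (.ext u')) (.ext v) (.ext w) z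
    rw [curvatureField_add_left hn (.ext u) (.ext u') (.ext w), inner_add_left] at h
    simpa using! h
  map_smul c u := by
    have h := curvature_eq_inner hn (SmoothNear.smul (.const c) (.ext u)) (.ext v) (.ext w) z
    rw [curvatureField_smul_left hn (.const c) (.ext u) (.ext w), inner_smul_left] at h
    simpa using! h

lemma isLinearMap_curvature₂ (u w z : TangentSpace I x) :
    IsLinearMap ℝ (fun v ↦ curvature nabla x u v w z) := by
  simp only [curvature_swap u]
  exact ⟨fun v v' ↦ by rw [(isLinearMap_curvature₁ hn u w z).map_add]; ring,
    fun c v ↦ by rw [(isLinearMap_curvature₁ hn u w z).map_smul]; simp⟩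

lemma isLinearMap_curvature₃ (u v z : TangentSpace I x) :
    IsLinearMap ℝ (fun w ↦ curvature nabla x u v w z) where
  map_add w w' := by
    have h := curvature_eq_inner hn (.ext u) (.ext v) ((SmoothNear.ext w).add (.ext w')) z
    rw [curvatureField_add_right hn (.ext u) (.ext v) (.ext w) (.ext w'), inner_add_left] at h
    simpa using! h
  map_smul c w := by
    have h := curvature_eq_inner hn (.ext u) (.ext v) (SmoothNear.smul (.const c) (.ext w)) z
    rw [curvatureField_smul_right hn (.const c) (.ext u) (.ext v) (.ext w), inner_smul_left] at h
    simpa using! h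

omit hn [T2Space M] [IsContMDiffRiemannianBundle I ∞ E (fun x : M ↦ TangentSpace I x)]
  [FiniteDimensional ℝ E] in
lemma isLinearMap_curvature₄ (u v w : TangentSpace I x) :
    IsLinearMap ℝ (fun z ↦ curvature nabla x u v w z) where
  map_add _ _ := inner_add_right ..
  map_smul _ _ := inner_smul_right ..

end Curvature

/-! ### Bianchi identities of a connection with torsion -/

section Bianchi

variable {E : Type*} [NormedAddCommGroup E] [NormedSpace ℝ E] [FiniteDimensional ℝ E]
  {H : Type*} [TopologicalSpace H] {I : ModelWithCorners ℝ E H}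
  {M : Type*} [TopologicalSpace M] [ChartedSpace H M] [IsManifold I ∞ M]
  {x : M} {X Y Z V W : Π y : M, TangentSpace I y}
  {nabla : CovariantDerivative I E (TangentSpace I : M → Type _)}

lemma SmoothNear.jacobi (hX : SmoothNear x X) (hY : SmoothNear x Y) (hZ : SmoothNear x Z) :
    VectorField.mlieBracket I (VectorField.mlieBracket I X Y) Z x
      + VectorField.mlieBracket I (VectorField.mlieBracket I Y Z) X x
      + VectorField.mlieBracket I (VectorField.mlieBracket I Z X) Y x = 0 := by
  have h2 : (minSmoothness ℝ 2) ≤ ∞ := by simpa using! ENat.LEInfty.out (m := 2)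
  have key := leibniz_identity_mlieBracket_apply (hX.contMDiffAt.of_le h2)
    (hY.contMDiffAt.of_le h2) (hZ.contMDiffAt.of_le h2)
  have hXZ : VectorField.mlieBracket I Y (VectorField.mlieBracket I X Z) x
      = VectorField.mlieBracket I (VectorField.mlieBracket I Z X) Y x := by
    rw [mlieBracket_swap_apply, mlieBracket_swap (V := X),
      ← neg_one_smul ℝ (VectorField.mlieBracket I Z X),
      mlieBracket_const_smul_left (hZ.mlieBracket hX).mdifferentiableAt]
    simp
  rw [mlieBracket_swap_apply, hXZ] at key
  rw [add_right_comm, ← key]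
  simp

lemma SmoothNear.torsion_apply (hX : SmoothNear x X) (hY : SmoothNear x Y) :
    nabla.torsion x (X x) (Y x)
      = nabla Y x (X x) - nabla X x (Y x) - VectorField.mlieBracket I X Y x :=
  nabla.torsion_apply hX.mdifferentiableAt hY.mdifferentiableAt

variable [T2Space M] (hn : nabla.ContMDiffCovariantDerivative ∞)
include hn

lemma SmoothNear.torsion (hX : SmoothNear x X) (hY : SmoothNear x Y) :
    SmoothNear x (fun y ↦ nabla.torsion y (X y) (Y y)) := by
  refine (((SmoothNear.covDeriv hn hX hY).sub (.covDeriv hn hY hX)).sub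
    (hX.mlieBracket hY)).congr ?_
  filter_upwards [hX.eventually, hY.eventually] with y h1 h2 using h1.torsion_apply h2

/-- The first Bianchi identity of a connection with torsion. -/
lemma firstBianchi (hX : SmoothNear x X) (hY : SmoothNear x Y) (hZ : SmoothNear x Z) :
    curvatureField nabla X Y Z x + curvatureField nabla Y Z X x + curvatureField nabla Z X Y x
      = nabla (fun y ↦ nabla.torsion y (Y y) (Z y)) x (X x)
          - nabla.torsion x (nabla Y x (X x)) (Z x) - nabla.torsion x (Y x) (nabla Z x (X x))
          + nabla.torsion x (nabla.torsion x (X x) (Y x)) (Z x)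
        + (nabla (fun y ↦ nabla.torsion y (Z y) (X y)) x (Y x)
          - nabla.torsion x (nabla Z x (Y x)) (X x) - nabla.torsion x (Z x) (nabla X x (Y x))
          + nabla.torsion x (nabla.torsion x (Y x) (Z x)) (X x))
        + (nabla (fun y ↦ nabla.torsion y (X y) (Y y)) x (Z x)
          - nabla.torsion x (nabla X x (Z x)) (Y x) - nabla.torsion x (X x) (nabla Y x (Z x))
          + nabla.torsion x (nabla.torsion x (Z x) (X x)) (Y x)) := by
  -- Expand T(Y, Z) by its definition, then trade ∇_X [Y, Z] for ∇_{[Y, Z]} X using the torsion of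
  -- the pair [Y, Z], X. The double brackets that appear sum to zero by Jacobi.
  have key : ∀ {X Y Z : Π y : M, TangentSpace I y}, SmoothNear x X → SmoothNear x Y →
      SmoothNear x Z →
      nabla (fun y ↦ nabla.torsion y (Y y) (Z y)) x (X x)
        = nabla (fun y ↦ nabla Z y (Y y)) x (X x) - nabla (fun y ↦ nabla Y y (Z y)) x (X x)
          + nabla.torsion x (nabla Z x (Y x)) (X x) - nabla.torsion x (nabla Y x (Z x)) (X x)
          - nabla.torsion x (nabla.torsion x (Y x) (Z x)) (X x)
          - nabla X x (mlieBracket I Y Z x) + mlieBracket I (mlieBracket I Y Z) X x := by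
    intro X Y Z hX hY hZ
    have h1 := SmoothNear.covDeriv hn hY hZ
    have h2 := SmoothNear.covDeriv hn hZ hY
    have h3 := hY.mlieBracket hZ
    have h : ∀ᶠ y in 𝓝 x, nabla.torsion y (Y y) (Z y)
        = ((fun y ↦ nabla Z y (Y y)) - (fun y ↦ nabla Y y (Z y)) - mlieBracket I Y Z) y := by
      filter_upwards [hY.eventually, hZ.eventually] with y h1 h2 using h1.torsion_apply h2
    have e1 : nabla (fun y ↦ nabla.torsion y (Y y) (Z y)) x (X x)
        = nabla (fun y ↦ nabla Z y (Y y)) x (X x) - nabla (fun y ↦ nabla Y y (Z y)) x (X x)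
          - nabla (mlieBracket I Y Z) x (X x) := by
      rw [covDeriv_congr ((h1.sub h2).sub h3) h, covDeriv_sub (h1.sub h2) h3, covDeriv_sub h1 h2]
      rfl
    have e2 := h3.torsion_apply (nabla := nabla) hX
    have e3 : mlieBracket I Y Z x
        = nabla Z x (Y x) - nabla Y x (Z x) - nabla.torsion x (Y x) (Z x) := by
      rw [hY.torsion_apply hZ]; abel
    have e4 : nabla.torsion x (mlieBracket I Y Z x) (X x)
        = nabla.torsion x (nabla Z x (Y x)) (X x) - nabla.torsion x (nabla Y x (Z x)) (X x)
          - nabla.torsion x (nabla.torsion x (Y x) (Z x)) (X x) := by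
      rw [e3]; simp
    linear_combination (norm := module) e1 + e4 - e2
  have hJ := hX.jacobi hY hZ
  rw [key hX hY hZ, key hY hZ hX, key hZ hX hY, nabla.torsion_antisymm (Y x) (nabla Z x (X x)),
    nabla.torsion_antisymm (Z x) (nabla X x (Y x)), nabla.torsion_antisymm (X x) (nabla Y x (Z x))]
  simp only [curvatureField]
  linear_combination (norm := module) -hJ

/-- The second Bianchi identity, before expressing Lie brackets through the torsion. -/
lemma secondBianchi_mlieBracket (hX : SmoothNear x X) (hY : SmoothNear x Y)
    (hZ : SmoothNear x Z) (hW : SmoothNear x W) :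
    nabla (curvatureField nabla Y Z W) x (X x)
        - curvatureField nabla Y Z (fun y ↦ nabla W y (X y)) x
        - curvatureField nabla (mlieBracket I X Y) Z W x
      + (nabla (curvatureField nabla Z X W) x (Y x)
        - curvatureField nabla Z X (fun y ↦ nabla W y (Y y)) x
        - curvatureField nabla (mlieBracket I Y Z) X W x)
      + (nabla (curvatureField nabla X Y W) x (Z x)
        - curvatureField nabla X Y (fun y ↦ nabla W y (Z y)) x
        - curvatureField nabla (mlieBracket I Z X) Y W x) = 0 := by
  have key : ∀ {X Y Z : Π y : M, TangentSpace I y}, SmoothNear x X → SmoothNear x Y →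
      SmoothNear x Z →
      nabla (curvatureField nabla Y Z W) x (X x)
        = nabla (fun y ↦ nabla (fun y ↦ nabla W y (Z y)) y (Y y)) x (X x)
          - nabla (fun y ↦ nabla (fun y ↦ nabla W y (Y y)) y (Z y)) x (X x)
          - nabla (fun y ↦ nabla W y (mlieBracket I Y Z y)) x (X x) := by
    intro X Y Z hX hY hZ
    have h1 := SmoothNear.covDeriv hn hY (.covDeriv hn hZ hW)
    have h2 := SmoothNear.covDeriv hn hZ (.covDeriv hn hY hW)
    have h3 := SmoothNear.covDeriv hn (hY.mlieBracket hZ) hW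
    have : curvatureField nabla Y Z W = (fun y ↦ nabla (fun y ↦ nabla W y (Z y)) y (Y y))
        - (fun y ↦ nabla (fun y ↦ nabla W y (Y y)) y (Z y))
        - (fun y ↦ nabla W y (mlieBracket I Y Z y)) := rfl
    rw [this, covDeriv_sub (h1.sub h2) h3, covDeriv_sub h1 h2]
    rfl
  have hJ := congrArg (nabla W x) (hX.jacobi hY hZ)
  simp only [map_add, map_zero] at hJ
  rw [key hX hY hZ, key hY hZ hX, key hZ hX hY]
  simp only [curvatureField]
  -- The iterated covariant derivatives cancel as in the Jacobi identity for commutators; what is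
  -- left is `W` differentiated along the cyclic sum of double brackets.
  linear_combination (norm := module) hJ

variable [RiemannianBundle (fun x : M ↦ TangentSpace I x)]
  [IsContMDiffRiemannianBundle I ∞ E (fun x : M ↦ TangentSpace I x)]

lemma SmoothNear.torsionForm (hX : SmoothNear x X) (hY : SmoothNear x Y) (hZ : SmoothNear x Z) :
    SmoothFunNear I x (fun y ↦ torsionForm nabla y (X y) (Y y) (Z y)) :=
  (SmoothNear.torsion hn hX hY).inner hZ

omit hn
omit [T2Space M] [IsContMDiffRiemannianBundle I ∞ E (fun x : M ↦ TangentSpace I x)]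

variable (nabla) in
/-- The covariant derivative `(∇_u T)(X, Y, Z)` of the torsion form. -/
def covDerivTorsion (x : M) (u : TangentSpace I x) (X Y Z : Π y : M, TangentSpace I y) : ℝ :=
  mvfderiv I (fun y ↦ SkewTorsion.torsionForm nabla y (X y) (Y y) (Z y)) x u
    - SkewTorsion.torsionForm nabla x (nabla X x u) (Y x) (Z x)
    - SkewTorsion.torsionForm nabla x (X x) (nabla Y x u) (Z x)
    - SkewTorsion.torsionForm nabla x (X x) (Y x) (nabla Z x u)

variable (nabla) in
/-- The covariant derivative `(∇_u R)(X, Y, Z, W)` of the curvature tensor. -/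
def covDerivCurvature (x : M) (u : TangentSpace I x) (X Y Z W : Π y : M, TangentSpace I y) : ℝ :=
  mvfderiv I (fun y ↦ SkewTorsion.curvature nabla y (X y) (Y y) (Z y) (W y)) x u
    - SkewTorsion.curvature nabla x (nabla X x u) (Y x) (Z x) (W x)
    - SkewTorsion.curvature nabla x (X x) (nabla Y x u) (Z x) (W x)
    - SkewTorsion.curvature nabla x (X x) (Y x) (nabla Z x u) (W x)
    - SkewTorsion.curvature nabla x (X x) (Y x) (Z x) (nabla W x u)

variable [T2Space M] [IsContMDiffRiemannianBundle I ∞ E (fun x : M ↦ TangentSpace I x)]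
include hn

variable (hmetric : IsMetric nabla)
include hmetric

omit [IsContMDiffRiemannianBundle I ∞ E (fun x : M ↦ TangentSpace I x)] in
-- Because ∇g = 0, the derivative passes inside the inner product and the term with ∇_u Z cancels.
lemma covDerivTorsion_eq_inner (hX : SmoothNear x X) (hY : SmoothNear x Y) (hZ : SmoothNear x Z)
    (u : TangentSpace I x) :
    covDerivTorsion nabla x u X Y Z
      = inner ℝ (nabla (fun y ↦ nabla.torsion y (X y) (Y y)) x u
          - nabla.torsion x (nabla X x u) (Y x) - nabla.torsion x (X x) (nabla Y x u)) (Z x) := by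
  have := hmetric x _ Z (SmoothNear.torsion hn hX hY).mdifferentiableAt hZ.mdifferentiableAt u
  simp only [covDerivTorsion, SkewTorsion.torsionForm, this, inner_sub_left]
  ring

lemma covDerivCurvature_eq_inner (hX : SmoothNear x X) (hY : SmoothNear x Y)
    (hZ : SmoothNear x Z) (hW : SmoothNear x W) (u : TangentSpace I x) :
    covDerivCurvature nabla x u X Y Z W
      = inner ℝ (nabla (curvatureField nabla X Y Z) x u) (W x)
        - curvature nabla x (nabla X x u) (Y x) (Z x) (W x)
        - curvature nabla x (X x) (nabla Y x u) (Z x) (W x)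
        - curvature nabla x (X x) (Y x) (nabla Z x u) (W x) := by
  have h1 := hmetric x _ W (SmoothNear.curvatureField hn hX hY hZ).mdifferentiableAt
    hW.mdifferentiableAt u
  have h2 : (fun y ↦ curvature nabla y (X y) (Y y) (Z y) (W y))
      =ᶠ[𝓝 x] fun y ↦ inner ℝ (curvatureField nabla X Y Z y) (W y) := by
    filter_upwards [hX.eventually, hY.eventually, hZ.eventually] with y h1 h2 h3
    exact curvature_eq_inner hn h1 h2 h3 _
  rw [covDerivCurvature, mvfderiv_congr h2, h1, curvature_eq_inner hn hX hY hZ (nabla W x u)]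
  ring

lemma firstBianchi_torsionForm (hX : SmoothNear x X) (hY : SmoothNear x Y)
    (hZ : SmoothNear x Z) (hV : SmoothNear x V) :
    curvature nabla x (X x) (Y x) (Z x) (V x) + curvature nabla x (Y x) (Z x) (X x) (V x)
        + curvature nabla x (Z x) (X x) (Y x) (V x)
      = covDerivTorsion nabla x (X x) Y Z V + covDerivTorsion nabla x (Y x) Z X V
        + covDerivTorsion nabla x (Z x) X Y V
        + torsionForm nabla x (nabla.torsion x (X x) (Y x)) (Z x) (V x)
        + torsionForm nabla x (nabla.torsion x (Y x) (Z x)) (X x) (V x)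
        + torsionForm nabla x (nabla.torsion x (Z x) (X x)) (Y x) (V x) := by
  rw [curvature_eq_inner hn hX hY hZ, curvature_eq_inner hn hY hZ hX,
    curvature_eq_inner hn hZ hX hY, covDerivTorsion_eq_inner hn hmetric hY hZ hV,
    covDerivTorsion_eq_inner hn hmetric hZ hX hV, covDerivTorsion_eq_inner hn hmetric hX hY hV,
    ← inner_add_left, ← inner_add_left, firstBianchi hn hX hY hZ]
  simp only [SkewTorsion.torsionForm, inner_add_left, inner_sub_left]
  ring

lemma secondBianchi (hX : SmoothNear x X) (hY : SmoothNear x Y)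
    (hZ : SmoothNear x Z) (hW : SmoothNear x W) (hV : SmoothNear x V) :
    covDerivCurvature nabla x (X x) Y Z W V + covDerivCurvature nabla x (Y x) Z X W V
      + covDerivCurvature nabla x (Z x) X Y W V
      + curvature nabla x (nabla.torsion x (X x) (Y x)) (Z x) (W x) (V x)
      + curvature nabla x (nabla.torsion x (Y x) (Z x)) (X x) (W x) (V x)
      + curvature nabla x (nabla.torsion x (Z x) (X x)) (Y x) (W x) (V x) = 0 := by
  -- Substitute [X, Y] = ∇_X Y - ∇_Y X - T(X, Y). The remaining R(∇_Y X, Z) and R(Y, ∇_X Z) terms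
  -- cancel in the cyclic sum, up to a swap of the first two slots.
  have key : ∀ {X Y Z : Π y : M, TangentSpace I y}, SmoothNear x X → SmoothNear x Y →
      SmoothNear x Z → inner ℝ (nabla (curvatureField nabla Y Z W) x (X x)
        - curvatureField nabla Y Z (fun y ↦ nabla W y (X y)) x
        - curvatureField nabla (mlieBracket I X Y) Z W x) (V x)
      = covDerivCurvature nabla x (X x) Y Z W V
        + curvature nabla x (nabla.torsion x (X x) (Y x)) (Z x) (W x) (V x)
        + curvature nabla x (nabla X x (Y x)) (Z x) (W x) (V x)
        - curvature nabla x (nabla X x (Z x)) (Y x) (W x) (V x)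
        + curvature nabla x (Y x) (nabla Z x (X x)) (W x) (V x)
        + curvature nabla x (nabla X x (Z x)) (Y x) (W x) (V x) := by
    intro X Y Z hX hY hZ
    rw [covDerivCurvature_eq_inner hn hmetric hY hZ hW hV, inner_sub_left, inner_sub_left,
      ← curvature_eq_inner hn (hX.mlieBracket hY) hZ hW,
      ← curvature_eq_inner hn hY hZ (.covDeriv hn hX hW), hX.torsion_apply hY]
    have h := isLinearMap_curvature₁ hn (Z x) (W x) (V x)
    rw [h.map_sub, h.map_sub]
    ring
  have h := congrArg (fun v ↦ inner ℝ v (V x)) (secondBianchi_mlieBracket hn hX hY hZ hW)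
  simp only [inner_add_left, inner_zero_left, key hX hY hZ, key hY hZ hX, key hZ hX hY] at h
  rw [curvature_swap (Y x) (nabla Z x (X x)), curvature_swap (Z x) (nabla X x (Y x)),
    curvature_swap (X x) (nabla Y x (Z x))] at h
  linear_combination h

end Bianchi

/-! ### Traces of bilinear forms in orthonormal bases -/

section Trace

variable {V : Type*} [NormedAddCommGroup V] [InnerProductSpace ℝ V]
  {ι κ : Type*} [Fintype ι] [Fintype κ]

lemma _root_.IsLinearMap.eq_sum_inner {f : V → ℝ} (hf : IsLinearMap ℝ f)
    (b : OrthonormalBasis ι ℝ V) (v : V) : f v = ∑ i, inner ℝ (b i) v * f (b i) := by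
  have := congrArg (hf.mk' f) (b.sum_repr' v)
  simpa using this.symm

/-- The trace of a bilinear form does not depend on the orthonormal basis. -/
lemma sum_bilin_orthonormalBasis {B : V → V → ℝ} (h1 : ∀ v, IsLinearMap ℝ (B · v))
    (h2 : ∀ u, IsLinearMap ℝ (B u)) (b : OrthonormalBasis ι ℝ V) (c : OrthonormalBasis κ ℝ V) :
    ∑ j, B (c j) (c j) = ∑ i, B (b i) (b i) := by
  calc ∑ j, B (c j) (c j) = ∑ j, ∑ i, inner ℝ (b i) (c j) * B (b i) (c j) :=
        Finset.sum_congr rfl fun j _ ↦ (h1 (c j)).eq_sum_inner b (c j)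
    _ = ∑ i, ∑ j, inner ℝ (c j) (b i) * B (b i) (c j) := by
        rw [Finset.sum_comm]
        simp only [real_inner_comm]
    _ = ∑ i, B (b i) (b i) :=
        Finset.sum_congr rfl fun i _ ↦ ((h2 (b i)).eq_sum_inner c (b i)).symm

/-- The trace of a bilinear form is invariant under infinitesimal rotations of the basis. -/
lemma sum_bilin_skew {B : V → V → ℝ} (h1 : ∀ v, IsLinearMap ℝ (B · v))
    (h2 : ∀ u, IsLinearMap ℝ (B u)) (b : OrthonormalBasis ι ℝ V) {D : ι → V}
    (hD : ∀ i j, inner ℝ (b j) (D i) = -inner ℝ (b i) (D j)) :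
    ∑ i, (B (D i) (b i) + B (b i) (D i)) = 0 := by
  rw [Finset.sum_add_distrib]
  have e1 : ∑ i, B (D i) (b i) = ∑ i, ∑ j, inner ℝ (b j) (D i) * B (b j) (b i) :=
    Finset.sum_congr rfl fun i _ ↦ (h1 (b i)).eq_sum_inner b (D i)
  have e2 : ∑ i, B (b i) (D i) = ∑ i, ∑ j, inner ℝ (b j) (D i) * B (b i) (b j) :=
    Finset.sum_congr rfl fun i _ ↦ (h2 (b i)).eq_sum_inner b (D i)
  rw [e1, e2, Finset.sum_comm, ← Finset.sum_add_distrib]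
  refine Finset.sum_eq_zero fun i _ ↦ ?_
  rw [← Finset.sum_add_distrib]
  refine Finset.sum_eq_zero fun j _ ↦ ?_
  rw [hD j i]; ring

/-- Contracting a symmetric with a skew-symmetric array gives zero. -/
lemma sum_mul_eq_zero_of_skew {s a : ι → ι → ℝ} (hs : ∀ i j, s i j = s j i)
    (ha : ∀ i j, a i j = -a j i) : ∑ i, ∑ j, a i j * s i j = 0 := by
  have : ∑ i, ∑ j, a i j * s i j = -∑ i, ∑ j, a i j * s i j := by
    conv_lhs => rw [Finset.sum_comm]
    simp only [← Finset.sum_neg_distrib]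
    refine Finset.sum_congr rfl fun i _ ↦ Finset.sum_congr rfl fun j _ ↦ ?_
    rw [ha, hs]; ring
  linarith

end Trace

/-! ### Smooth local orthonormal frames -/

section Frame

variable {E : Type*} [NormedAddCommGroup E] [NormedSpace ℝ E]
  {H : Type*} [TopologicalSpace H] {I : ModelWithCorners ℝ E H}
  {M : Type*} [TopologicalSpace M] [ChartedSpace H M]
  {x : M}

lemma SmoothFunNear.sum {ι : Type*} {s : Finset ι} {f : ι → M → ℝ}
    (hf : ∀ i ∈ s, SmoothFunNear I x (f i)) : SmoothFunNear I x (fun y ↦ ∑ i ∈ s, f i y) := by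
  have : ∀ᶠ y in 𝓝 x, ∀ i ∈ s, CMDiffAt ∞ (f i) y := (Finset.eventually_all s).2 hf
  filter_upwards [this] with y h using contMDiffAt_finsetSum h

lemma mvfderiv_sum {ι : Type*} {s : Finset ι} {f : ι → M → ℝ}
    (hf : ∀ i ∈ s, SmoothFunNear I x (f i)) (u : TangentSpace I x) :
    mvfderiv I (fun y ↦ ∑ i ∈ s, f i y) x u = ∑ i ∈ s, mvfderiv I (f i) x u := by
  classical
  induction s using Finset.induction_on with
  | empty => simp [mvfderiv_const]
  | insert a s ha ih =>
    have h := fun i hi ↦ hf i (Finset.mem_insert_of_mem hi)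
    simp only [Finset.sum_insert ha]
    rw [mvfderiv_fun_add (hf a (Finset.mem_insert_self ..)).mdifferentiableAt
      (SmoothFunNear.sum h).mdifferentiableAt, add_apply, ih h]

variable [FiniteDimensional ℝ E] [IsManifold I ∞ M]
  [RiemannianBundle (fun x : M ↦ TangentSpace I x)]

/-- A smooth orthonormal frame near `x`, extending the chosen orthonormal basis at `x`. -/
structure OrthonormalFrameNear (x : M)
    (F : Fin (Module.finrank ℝ (TangentSpace I x)) → Π y : M, TangentSpace I y) : Prop where
  smooth : ∀ i, SmoothNear x (F i)
  self : ∀ i, F i x = onb I x i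
  orthonormal : ∀ᶠ y in 𝓝 x,
    ∃ b : OrthonormalBasis (Fin (Module.finrank ℝ (TangentSpace I x))) ℝ (TangentSpace I y),
      ∀ i, b i = F i y

variable [IsContMDiffRiemannianBundle I ∞ E (fun x : M ↦ TangentSpace I x)]

open InnerProductSpace in
variable (I) in
/-- Orthonormal frames exist, by the Gram-Schmidt process. -/
lemma exists_orthonormalFrameNear (x : M) :
    ∃ F : Fin (Module.finrank ℝ (TangentSpace I x)) → Π y : M, TangentSpace I y,
      OrthonormalFrameNear x F := by
  let f : Fin (Module.finrank ℝ (TangentSpace I x)) → Π y : M, TangentSpace I y :=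
    fun i ↦ ext (onb I x i)
  let G : Fin (Module.finrank ℝ (TangentSpace I x)) → Π y : M, TangentSpace I y :=
    fun i y ↦ gramSchmidt ℝ (fun j ↦ f j y) i
  -- The fields are already orthonormal at `x`, so Gram-Schmidt leaves them unchanged there; in
  -- particular the norms to divide by are nonzero near `x`.
  have hGx : ∀ i, G i x = onb I x i := by
    intro i
    have h : (fun j ↦ f j x) = onb I x := by ext j; simp [f]
    have : gramSchmidt ℝ (onb I x) = onb I x :=
      gramSchmidt_of_orthogonal ℝ fun i j hij ↦ (onb I x).orthonormal.2 hij
    simp only [G, h, this]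
  have hG0 : ∀ i, inner ℝ (G i x) (G i x) ≠ (0 : ℝ) := fun i ↦ by simp [hGx]
  have hG : ∀ i, SmoothNear x (G i) := by
    intro i
    induction i using WellFoundedLT.induction with
    | ind i ih =>
      have hs : ∀ j ∈ Finset.Iio i, SmoothNear x
          (((fun y ↦ inner ℝ (G j y) (f i y)) * (fun y ↦ inner ℝ (G j y) (G j y))⁻¹ : M → ℝ)
            • G j) := fun j hj ↦
        have hj := ih j (Finset.mem_Iio.1 hj)
        .smul ((hj.inner (.ext _)).mul ((hj.inner hj).inv₀ (hG0 j))) hj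
      refine ((SmoothNear.ext (onb I x i)).sub (.sum hs)).congr (.of_forall fun y ↦ ?_)
      simp only [G]
      rw [gramSchmidt_def]
      simp only [Submodule.starProjection_singleton, Pi.sub_apply, Pi.smul_apply', Pi.mul_apply,
        Pi.inv_apply, real_inner_self_eq_norm_sq, div_eq_mul_inv, f]
      rfl
  let r : Fin (Module.finrank ℝ (TangentSpace I x)) → M → ℝ :=
    fun i y ↦ Real.sqrt (inner ℝ (G i y) (G i y))
  refine ⟨fun i ↦ (r i)⁻¹ • G i, fun i ↦ ?_, fun i ↦ ?_, ?_⟩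
  · exact .smul ((((hG i).inner (hG i)).sqrt (hG0 i)).inv₀ (by simp [hGx])) (hG i)
  · simp [r, hGx]
  · have h : ∀ᶠ y in 𝓝 x, ∀ i, inner ℝ (G i y) (G i y) ≠ (0 : ℝ) :=
      eventually_all.2 fun i ↦
        ((hG i).inner (hG i)).contMDiffAt.continuousAt.eventually_ne (hG0 i)
    filter_upwards [h] with y hy
    have hon : Orthonormal ℝ fun i ↦ ((r i)⁻¹ • G i) y := by
      refine ⟨fun i ↦ ?_, fun i j hij ↦ ?_⟩
      · have : ‖G i y‖ ≠ 0 := fun h ↦ hy i (by simp [h])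
        simp [r, norm_smul, this]
      · have : inner ℝ (G i y) (G j y) = (0 : ℝ) := gramSchmidt_orthogonal ℝ _ hij
        simp [inner_smul_left, inner_smul_right, this]
    -- The index set is sized by the tangent space at `x`; all tangent spaces are modelled on `E`,
    -- so the count is right at `y` as well.
    have hspan := hon.linearIndependent.span_eq_top_of_card_eq_finrank' (by simp; rfl)
    exact ⟨OrthonormalBasis.mk hon hspan.ge, fun i ↦ by simp⟩

variable {F : Fin (Module.finrank ℝ (TangentSpace I x)) → Π y : M, TangentSpace I y}

omit [FiniteDimensional ℝ E]
  [IsContMDiffRiemannianBundle I ∞ E (fun x : M ↦ TangentSpace I x)] in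
-- Differentiate ⟨F_i, F_j⟩ = δ_ij: the connection matrix of an orthonormal frame is skew. This
-- supplies the infinitesimal rotation that the trace lemmas ask for.
lemma OrthonormalFrameNear.inner_covDeriv [FiniteDimensional ℝ E] (hF : OrthonormalFrameNear x F)
    {nabla : CovariantDerivative I E (TangentSpace I : M → Type _)} (hmetric : IsMetric nabla)
    (u : TangentSpace I x) (i j : Fin (Module.finrank ℝ (TangentSpace I x))) :
    inner ℝ (onb I x j) (nabla (F i) x u) = -inner ℝ (onb I x i) (nabla (F j) x u) := by
  have h1 := hmetric x (F i) (F j) (hF.smooth i).mdifferentiableAt (hF.smooth j).mdifferentiableAt u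
  have h2 : (fun y ↦ inner ℝ (F i y) (F j y)) =ᶠ[𝓝 x] fun _ ↦ (if i = j then 1 else 0 : ℝ) := by
    filter_upwards [hF.orthonormal] with y ⟨b, hb⟩
    rw [← hb, ← hb, b.inner_eq_ite]
  rw [mvfderiv_congr h2, mvfderiv_const] at h1
  rw [← hF.self i, ← hF.self j, real_inner_comm]
  have h3 : (0 : ℝ) = inner ℝ (nabla (F i) x u) (F j x) + inner ℝ (F i x) (nabla (F j) x u) := h1
  linarith

end Frame

/-! ### Norms of linear and trilinear forms in orthonormal bases -/

section Trace

variable {V : Type*} [NormedAddCommGroup V] [InnerProductSpace ℝ V]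
  {ι κ : Type*} [Fintype ι] [Fintype κ]

/-- The norm of a linear form does not depend on the orthonormal basis. -/
lemma _root_.IsLinearMap.sum_sq_orthonormalBasis {f : V → ℝ} (hf : IsLinearMap ℝ f)
    (b : OrthonormalBasis ι ℝ V) (c : OrthonormalBasis κ ℝ V) :
    ∑ j, f (c j) ^ 2 = ∑ i, f (b i) ^ 2 := by
  have h : ∀ a : ℝ, IsLinearMap ℝ fun u ↦ f u * a := fun a ↦
    ⟨fun u v ↦ by rw [hf.map_add, add_mul], fun r u ↦ by
      rw [hf.map_smul, smul_eq_mul, smul_eq_mul, mul_assoc]⟩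
  simpa only [sq] using sum_bilin_orthonormalBasis (B := fun u v ↦ f u * f v) (fun v ↦ h (f v))
    (fun u ↦ by simpa only [mul_comm (f u)] using h (f u)) b c

/-- The norm of a linear form is invariant under infinitesimal rotations of the basis. -/
lemma _root_.IsLinearMap.sum_mul_eq_zero_of_skew {f : V → ℝ} (hf : IsLinearMap ℝ f)
    (b : OrthonormalBasis ι ℝ V) {D : ι → V}
    (hD : ∀ i j, inner ℝ (b j) (D i) = -inner ℝ (b i) (D j)) :
    ∑ i, f (b i) * f (D i) = 0 := by
  simp only [fun i ↦ hf.eq_sum_inner b (D i), Finset.mul_sum]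
  rw [← SkewTorsion.sum_mul_eq_zero_of_skew (s := fun i j ↦ f (b i) * f (b j))
    (fun i j ↦ mul_comm _ _) hD]
  refine Finset.sum_congr rfl fun i _ ↦ Finset.sum_congr rfl fun j _ ↦ ?_
  ring

/-- The norm of a trilinear form does not depend on the orthonormal basis. -/
lemma sum_sq_trilin_orthonormalBasis {f : V → V → V → ℝ} (h1 : ∀ v w, IsLinearMap ℝ (f · v w))
    (h2 : ∀ u w, IsLinearMap ℝ (f u · w)) (h3 : ∀ u v, IsLinearMap ℝ (f u v))
    (b : OrthonormalBasis ι ℝ V) (c : OrthonormalBasis κ ℝ V) :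
    ∑ i, ∑ j, ∑ k, f (c i) (c j) (c k) ^ 2 = ∑ i, ∑ j, ∑ k, f (b i) (b j) (b k) ^ 2 := by
  calc ∑ i, ∑ j, ∑ k, f (c i) (c j) (c k) ^ 2
      = ∑ i, ∑ k, ∑ j, f (c i) (c j) (b k) ^ 2 :=
        Finset.sum_congr rfl fun i _ ↦ by
          conv_rhs => rw [Finset.sum_comm]
          exact Finset.sum_congr rfl fun j _ ↦ (h3 _ _).sum_sq_orthonormalBasis b c
    _ = ∑ i, ∑ k, ∑ j, f (c i) (b j) (b k) ^ 2 :=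
        Finset.sum_congr rfl fun i _ ↦ Finset.sum_congr rfl fun k _ ↦
          (h2 _ _).sum_sq_orthonormalBasis b c
    _ = ∑ k, ∑ j, ∑ i, f (c i) (b j) (b k) ^ 2 := by
        rw [Finset.sum_comm]
        exact Finset.sum_congr rfl fun k _ ↦ Finset.sum_comm
    _ = ∑ k, ∑ j, ∑ i, f (b i) (b j) (b k) ^ 2 :=
        Finset.sum_congr rfl fun k _ ↦ Finset.sum_congr rfl fun j _ ↦
          (h1 _ _).sum_sq_orthonormalBasis b c
    _ = ∑ i, ∑ j, ∑ k, f (b i) (b j) (b k) ^ 2 := by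
        simp only [Finset.sum_comm (f := fun j i ↦ f (b i) (b j) (b _) ^ 2)]
        rw [Finset.sum_comm]
        exact Finset.sum_congr rfl fun i _ ↦ Finset.sum_comm

end Trace

/-! ### Derivatives of the Ricci tensor, the scalar curvature and the torsion norm -/

section Contractions

variable {E : Type*} [NormedAddCommGroup E] [NormedSpace ℝ E] [FiniteDimensional ℝ E]
  {H : Type*} [TopologicalSpace H] {I : ModelWithCorners ℝ E H}
  {M : Type*} [TopologicalSpace M] [T2Space M] [ChartedSpace H M] [IsManifold I ∞ M]
  [RiemannianBundle (fun x : M ↦ TangentSpace I x)]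
  [IsContMDiffRiemannianBundle I ∞ E (fun x : M ↦ TangentSpace I x)]
  {x : M} {U U' V V' : Π y : M, TangentSpace I y}
  {nabla : CovariantDerivative I E (TangentSpace I : M → Type _)}
  {F : Fin (Module.finrank ℝ (TangentSpace I x)) → Π y : M, TangentSpace I y}

section

variable (hn : nabla.ContMDiffCovariantDerivative ∞)
include hn

lemma isLinearMap_ricci₁ (v : TangentSpace I x) : IsLinearMap ℝ (fun u ↦ ricci nabla x u v) where
  map_add u u' := by
    simp only [ricci, ← Finset.sum_add_distrib]
    exact Finset.sum_congr rfl fun i _ ↦ (isLinearMap_curvature₂ hn _ _ _).map_add _ _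
  map_smul c u := by
    simp only [ricci, Finset.smul_sum]
    exact Finset.sum_congr rfl fun i _ ↦ (isLinearMap_curvature₂ hn _ _ _).map_smul _ _

lemma isLinearMap_ricci₂ (u : TangentSpace I x) : IsLinearMap ℝ (fun v ↦ ricci nabla x u v) where
  map_add v v' := by
    simp only [ricci, ← Finset.sum_add_distrib]
    exact Finset.sum_congr rfl fun i _ ↦ (isLinearMap_curvature₃ hn _ _ _).map_add _ _
  map_smul c v := by
    simp only [ricci, Finset.smul_sum]
    exact Finset.sum_congr rfl fun i _ ↦ (isLinearMap_curvature₃ hn _ _ _).map_smul _ _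

/-- The bases `onb I y` need not depend smoothly on `y`; basis independence of the trace replaces
them by a smooth frame. -/
lemma OrthonormalFrameNear.ricci (hF : OrthonormalFrameNear x F) :
    ∀ᶠ y in 𝓝 x, ∀ u v : TangentSpace I y,
      ricci nabla y u v = ∑ i, curvature nabla y (F i y) u v (F i y) := by
  filter_upwards [hF.orthonormal] with y ⟨b, hb⟩ u v
  simp only [← hb]
  exact sum_bilin_orthonormalBasis (B := fun a c ↦ curvature nabla y a u v c)
    (fun c ↦ isLinearMap_curvature₁ hn u v c) (fun a ↦ isLinearMap_curvature₄ a u v) b (onb I y)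

lemma OrthonormalFrameNear.scal (hF : OrthonormalFrameNear x F) :
    scal nabla =ᶠ[𝓝 x] fun y ↦ ∑ i, SkewTorsion.ricci nabla y (F i y) (F i y) := by
  filter_upwards [hF.orthonormal] with y ⟨b, hb⟩
  simp only [← hb]
  exact sum_bilin_orthonormalBasis (B := SkewTorsion.ricci nabla y)
    (isLinearMap_ricci₁ hn) (isLinearMap_ricci₂ hn) b (onb I y)

lemma SmoothNear.ricci (hU : SmoothNear x U) (hV : SmoothNear x V) :
    SmoothFunNear I x (fun y ↦ ricci nabla y (U y) (V y)) := by
  obtain ⟨F, hF⟩ := exists_orthonormalFrameNear I x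
  exact (SmoothFunNear.sum fun i _ ↦
    SmoothNear.curvature hn (hF.smooth i) hU hV (hF.smooth i)).congr
      ((hF.ricci hn).mono fun y hy ↦ hy _ _)

/-- The covariant derivative of the Ricci tensor may be computed with arbitrary smooth fields. -/
lemma covDerivBilin_ricci (hU : SmoothNear x U) (hV : SmoothNear x V) (w : TangentSpace I x) :
    covDerivBilin nabla (ricci nabla) x w (U x) (V x)
      = mvfderiv I (fun y ↦ ricci nabla y (U y) (V y)) x w
        - ricci nabla x (nabla U x w) (V x) - ricci nabla x (U x) (nabla V x w) := by
  -- The right-hand side is tensorial in each slot, so each field may be exchanged for the chart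
  -- extension of its value.
  have left : ∀ {U U' V : Π y : M, TangentSpace I y}, SmoothNear x U → SmoothNear x U' →
      SmoothNear x V → U x = U' x →
      mvfderiv I (fun y ↦ ricci nabla y (U y) (V y)) x w
        - ricci nabla x (nabla U x w) (V x) - ricci nabla x (U x) (nabla V x w)
      = mvfderiv I (fun y ↦ ricci nabla y (U' y) (V y)) x w
        - ricci nabla x (nabla U' x w) (V x) - ricci nabla x (U' x) (nabla V x w) := by
    intro U U' V hU hU' hV h
    refine eq_of_tensorial (Φ := fun U ↦ mvfderiv I (fun y ↦ ricci nabla y (U y) (V y)) x w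
        - ricci nabla x (nabla U x w) (V x) - ricci nabla x (U x) (nabla V x w)) ?_ ?_ hU hU' h
    · intro f X hf hX
      have e : (fun y ↦ ricci nabla y ((f • X) y) (V y))
          = f * fun y ↦ ricci nabla y (X y) (V y) :=
        funext fun y ↦ (isLinearMap_ricci₁ hn (V y)).map_smul (f y) (X y)
      rw [e, mvfderiv_mul hf.mdifferentiableAt (SmoothNear.ricci hn hX hV).mdifferentiableAt,
        covDeriv_smul hf hX, (isLinearMap_ricci₁ hn _).map_add, (isLinearMap_ricci₁ hn _).map_smul,
        (isLinearMap_ricci₁ hn _).map_smul, Pi.smul_apply', (isLinearMap_ricci₁ hn _).map_smul]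
      simp only [add_apply, smul_apply, smul_eq_mul]
      ring
    · intro X Y hX hY
      have e : (fun y ↦ ricci nabla y ((X + Y) y) (V y))
          = fun y ↦ ricci nabla y (X y) (V y) + ricci nabla y (Y y) (V y) :=
        funext fun y ↦ (isLinearMap_ricci₁ hn (V y)).map_add (X y) (Y y)
      rw [e, mvfderiv_fun_add (SmoothNear.ricci hn hX hV).mdifferentiableAt
        (SmoothNear.ricci hn hY hV).mdifferentiableAt, covDeriv_add hX hY, add_apply, add_apply,
        (isLinearMap_ricci₁ hn _).map_add, Pi.add_apply, (isLinearMap_ricci₁ hn _).map_add]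
      ring
  have right : ∀ {U V V' : Π y : M, TangentSpace I y}, SmoothNear x U → SmoothNear x V →
      SmoothNear x V' → V x = V' x →
      mvfderiv I (fun y ↦ ricci nabla y (U y) (V y)) x w
        - ricci nabla x (nabla U x w) (V x) - ricci nabla x (U x) (nabla V x w)
      = mvfderiv I (fun y ↦ ricci nabla y (U y) (V' y)) x w
        - ricci nabla x (nabla U x w) (V' x) - ricci nabla x (U x) (nabla V' x w) := by
    intro U V V' hU hV hV' h
    refine eq_of_tensorial (Φ := fun V ↦ mvfderiv I (fun y ↦ ricci nabla y (U y) (V y)) x w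
        - ricci nabla x (nabla U x w) (V x) - ricci nabla x (U x) (nabla V x w)) ?_ ?_ hV hV' h
    · intro f X hf hX
      have e : (fun y ↦ ricci nabla y (U y) ((f • X) y))
          = f * fun y ↦ ricci nabla y (U y) (X y) :=
        funext fun y ↦ (isLinearMap_ricci₂ hn (U y)).map_smul (f y) (X y)
      rw [e, mvfderiv_mul hf.mdifferentiableAt (SmoothNear.ricci hn hU hX).mdifferentiableAt,
        covDeriv_smul hf hX, (isLinearMap_ricci₂ hn _).map_add, (isLinearMap_ricci₂ hn _).map_smul,
        (isLinearMap_ricci₂ hn _).map_smul, Pi.smul_apply', (isLinearMap_ricci₂ hn _).map_smul]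
      simp only [add_apply, smul_apply, smul_eq_mul]
      ring
    · intro X Y hX hY
      have e : (fun y ↦ ricci nabla y (U y) ((X + Y) y))
          = fun y ↦ ricci nabla y (U y) (X y) + ricci nabla y (U y) (Y y) :=
        funext fun y ↦ (isLinearMap_ricci₂ hn (U y)).map_add (X y) (Y y)
      rw [e, mvfderiv_fun_add (SmoothNear.ricci hn hU hX).mdifferentiableAt
        (SmoothNear.ricci hn hU hY).mdifferentiableAt, covDeriv_add hX hY, add_apply, add_apply,
        (isLinearMap_ricci₂ hn _).map_add, Pi.add_apply, (isLinearMap_ricci₂ hn _).map_add]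
      ring
  rw [left hU (.ext (U x)) hV (by simp), right (.ext _) hV (.ext (V x)) (by simp)]
  simp only [covDerivBilin, ext_self]

variable (hmetric : IsMetric nabla)
include hmetric

/-- Contraction commutes with ∇: the terms in which the frame itself is differentiated sum to zero
by `sum_bilin_skew`. -/
lemma OrthonormalFrameNear.mvfderiv_ricci (hF : OrthonormalFrameNear x F) (hU : SmoothNear x U)
    (hV : SmoothNear x V) (w : TangentSpace I x) :
    mvfderiv I (fun y ↦ SkewTorsion.ricci nabla y (U y) (V y)) x w
      = ∑ i, covDerivCurvature nabla x w (F i) U V (F i)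
        + SkewTorsion.ricci nabla x (nabla U x w) (V x)
        + SkewTorsion.ricci nabla x (U x) (nabla V x w) := by
  rw [mvfderiv_congr ((hF.ricci hn).mono fun y hy ↦ hy _ _),
    mvfderiv_sum fun i _ ↦ SmoothNear.curvature hn (hF.smooth i) hU hV (hF.smooth i)]
  have key := sum_bilin_skew (B := fun a c ↦ curvature nabla x a (U x) (V x) c)
    (fun c ↦ isLinearMap_curvature₁ hn _ _ c) (fun a ↦ isLinearMap_curvature₄ a _ _) (onb I x)
    (hF.inner_covDeriv hmetric w)
  simp only [SkewTorsion.ricci]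
  rw [← add_zero (_ + _ + _), ← key, ← Finset.sum_add_distrib, ← Finset.sum_add_distrib,
    ← Finset.sum_add_distrib]
  refine Finset.sum_congr rfl fun i _ ↦ ?_
  simp only [covDerivCurvature, hF.self]
  ring

lemma OrthonormalFrameNear.mvfderiv_scal (hF : OrthonormalFrameNear x F) (u : TangentSpace I x) :
    mvfderiv I (SkewTorsion.scal nabla) x u
      = ∑ j, ∑ i, covDerivCurvature nabla x u (F i) (F j) (F j) (F i) := by
  rw [mvfderiv_congr (hF.scal hn),
    mvfderiv_sum fun i _ ↦ SmoothNear.ricci hn (hF.smooth i) (hF.smooth i)]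
  have key := sum_bilin_skew (B := SkewTorsion.ricci nabla x)
    (isLinearMap_ricci₁ hn) (isLinearMap_ricci₂ hn) (onb I x) (hF.inner_covDeriv hmetric u)
  rw [← add_zero (∑ j, ∑ i, _), ← key, ← Finset.sum_add_distrib]
  refine Finset.sum_congr rfl fun j _ ↦ ?_
  rw [hF.mvfderiv_ricci hn hmetric (hF.smooth j) (hF.smooth j), hF.self]
  ring

lemma OrthonormalFrameNear.covDerivBilin_ricci (hF : OrthonormalFrameNear x F)
    (hU : SmoothNear x U) (hV : SmoothNear x V) (w : TangentSpace I x) :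
    covDerivBilin nabla (SkewTorsion.ricci nabla) x w (U x) (V x)
      = ∑ i, covDerivCurvature nabla x w (F i) U V (F i) := by
  rw [SkewTorsion.covDerivBilin_ricci hn hU hV, hF.mvfderiv_ricci hn hmetric hU hV]
  ring

end

omit [FiniteDimensional ℝ E] [T2Space M]
  [IsContMDiffRiemannianBundle I ∞ E (fun x : M ↦ TangentSpace I x)] in
lemma isLinearMap_torsionForm₁ [FiniteDimensional ℝ E] (v w : TangentSpace I x) :
    IsLinearMap ℝ (fun u ↦ torsionForm nabla x u v w) where
  map_add u u' := by
    rw [torsionForm, (nabla.torsion x).map_add, add_apply, inner_add_left]; rfl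
  map_smul c u := by
    rw [torsionForm, (nabla.torsion x).map_smul, smul_apply,
      real_inner_smul_left]; rfl

omit [FiniteDimensional ℝ E] [T2Space M]
  [IsContMDiffRiemannianBundle I ∞ E (fun x : M ↦ TangentSpace I x)] in
lemma isLinearMap_torsionForm₂ [FiniteDimensional ℝ E] (u w : TangentSpace I x) :
    IsLinearMap ℝ (fun v ↦ torsionForm nabla x u v w) where
  map_add v v' := by
    rw [torsionForm, (nabla.torsion x u).map_add, inner_add_left]; rfl
  map_smul c v := by
    rw [torsionForm, (nabla.torsion x u).map_smul, real_inner_smul_left]; rfl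

omit [FiniteDimensional ℝ E] [T2Space M]
  [IsContMDiffRiemannianBundle I ∞ E (fun x : M ↦ TangentSpace I x)] in
lemma isLinearMap_torsionForm₃ [FiniteDimensional ℝ E] (u v : TangentSpace I x) :
    IsLinearMap ℝ (fun w ↦ torsionForm nabla x u v w) where
  map_add _ _ := inner_add_right ..
  map_smul _ _ := inner_smul_right ..

omit [FiniteDimensional ℝ E] [T2Space M]
  [IsContMDiffRiemannianBundle I ∞ E (fun x : M ↦ TangentSpace I x)] in
lemma OrthonormalFrameNear.torsionNormSq [FiniteDimensional ℝ E] (hF : OrthonormalFrameNear x F) :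
    torsionNormSq nabla =ᶠ[𝓝 x]
      fun y ↦ ∑ i, ∑ j, ∑ k, torsionForm nabla y (F i y) (F j y) (F k y) ^ 2 := by
  filter_upwards [hF.orthonormal] with y ⟨b, hb⟩
  simp only [← hb, SkewTorsion.torsionNormSq]
  exact sum_sq_trilin_orthonormalBasis isLinearMap_torsionForm₁ isLinearMap_torsionForm₂
    isLinearMap_torsionForm₃ b (onb I y)

/-- `u(‖T‖²) = 2 ⟨T, ∇_u T⟩`. -/
lemma OrthonormalFrameNear.mvfderiv_torsionNormSq (hn : nabla.ContMDiffCovariantDerivative ∞)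
    (hmetric : IsMetric nabla) (hF : OrthonormalFrameNear x F) (u : TangentSpace I x) :
    mvfderiv I (SkewTorsion.torsionNormSq nabla) x u
      = 2 * ∑ i, ∑ j, ∑ k, torsionForm nabla x (onb I x i) (onb I x j) (onb I x k)
          * covDerivTorsion nabla x u (F i) (F j) (F k) := by
  have hT : ∀ i j k, SmoothFunNear I x (fun y ↦ torsionForm nabla y (F i y) (F j y) (F k y)) :=
    fun i j k ↦ SmoothNear.torsionForm hn (hF.smooth i) (hF.smooth j) (hF.smooth k)
  have hT2 : ∀ i j k,
      SmoothFunNear I x (fun y ↦ torsionForm nabla y (F i y) (F j y) (F k y) ^ 2) :=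
    fun i j k ↦ by simpa only [sq] using! (hT i j k).mul (hT i j k)
  have e : ∀ i j k, mvfderiv I (fun y ↦ torsionForm nabla y (F i y) (F j y) (F k y) ^ 2) x u
      = 2 * (torsionForm nabla x (onb I x i) (onb I x j) (onb I x k)
          * covDerivTorsion nabla x u (F i) (F j) (F k))
        + 2 * (torsionForm nabla x (onb I x i) (onb I x j) (onb I x k)
          * torsionForm nabla x (nabla (F i) x u) (onb I x j) (onb I x k))
        + 2 * (torsionForm nabla x (onb I x i) (onb I x j) (onb I x k)
          * torsionForm nabla x (onb I x i) (nabla (F j) x u) (onb I x k))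
        + 2 * (torsionForm nabla x (onb I x i) (onb I x j) (onb I x k)
          * torsionForm nabla x (onb I x i) (onb I x j) (nabla (F k) x u)) := by
    intro i j k
    have : (fun y ↦ torsionForm nabla y (F i y) (F j y) (F k y) ^ 2)
        = (fun y ↦ torsionForm nabla y (F i y) (F j y) (F k y))
          * fun y ↦ torsionForm nabla y (F i y) (F j y) (F k y) := by
      ext y; simp [sq]
    rw [this, mvfderiv_mul (hT i j k).mdifferentiableAt (hT i j k).mdifferentiableAt]
    simp only [add_apply, smul_apply, smul_eq_mul, covDerivTorsion, hF.self]
    ring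
  -- In each slot, the term with a differentiated frame vector contracts a symmetric array with the
  -- skew connection matrix.
  have hD := hF.inner_covDeriv hmetric u
  have z1 : ∑ i, ∑ j, ∑ k, torsionForm nabla x (onb I x i) (onb I x j) (onb I x k)
      * torsionForm nabla x (nabla (F i) x u) (onb I x j) (onb I x k) = 0 := by
    rw [Finset.sum_comm]
    refine Finset.sum_eq_zero fun j _ ↦ ?_
    rw [Finset.sum_comm]
    exact Finset.sum_eq_zero fun k _ ↦
      (isLinearMap_torsionForm₁ (onb I x j) (onb I x k)).sum_mul_eq_zero_of_skew (onb I x) hD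
  have z2 : ∑ i, ∑ j, ∑ k, torsionForm nabla x (onb I x i) (onb I x j) (onb I x k)
      * torsionForm nabla x (onb I x i) (nabla (F j) x u) (onb I x k) = 0 := by
    refine Finset.sum_eq_zero fun i _ ↦ ?_
    rw [Finset.sum_comm]
    exact Finset.sum_eq_zero fun k _ ↦
      (isLinearMap_torsionForm₂ (onb I x i) (onb I x k)).sum_mul_eq_zero_of_skew (onb I x) hD
  have z3 : ∑ i, ∑ j, ∑ k, torsionForm nabla x (onb I x i) (onb I x j) (onb I x k)
      * torsionForm nabla x (onb I x i) (onb I x j) (nabla (F k) x u) = 0 :=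
    Finset.sum_eq_zero fun i _ ↦ Finset.sum_eq_zero fun j _ ↦
      (isLinearMap_torsionForm₃ (onb I x i) (onb I x j)).sum_mul_eq_zero_of_skew (onb I x) hD
  rw [mvfderiv_congr hF.torsionNormSq, mvfderiv_sum fun i _ ↦ .sum fun j _ ↦ .sum fun k _ ↦
    hT2 i j k]
  simp only [mvfderiv_sum fun j _ ↦ SmoothFunNear.sum fun k _ ↦ hT2 _ j k,
    mvfderiv_sum fun k _ ↦ hT2 _ _ k, e, Finset.sum_add_distrib, ← Finset.mul_sum, z1, z2, z3,
    mul_zero, add_zero]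

lemma smoothFunNear_torsionNormSq (hn : nabla.ContMDiffCovariantDerivative ∞) (x : M) :
    SmoothFunNear I x (torsionNormSq nabla) := by
  obtain ⟨F, hF⟩ := exists_orthonormalFrameNear I x
  refine (SmoothFunNear.sum fun i _ ↦ .sum fun j _ ↦ .sum fun k _ ↦ ?_).congr hF.torsionNormSq
  have := SmoothNear.torsionForm hn (hF.smooth i) (hF.smooth j) (hF.smooth k)
  simpa only [sq] using! this.mul this

end Contractions

/-! ### Pair symmetry, skewness of ∇T and the contracted identity -/

section ContractedBianchi

variable {E : Type*} [NormedAddCommGroup E] [NormedSpace ℝ E]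
  {H : Type*} [TopologicalSpace H] {I : ModelWithCorners ℝ E H}
  {M : Type*} [TopologicalSpace M] [ChartedSpace H M] [IsManifold I ∞ M]
  [RiemannianBundle (fun x : M ↦ TangentSpace I x)]
  {x : M} {X Y Z U V W : Π y : M, TangentSpace I y}
  {nabla : CovariantDerivative I E (TangentSpace I : M → Type _)}
  {F : Fin (Module.finrank ℝ (TangentSpace I x)) → Π y : M, TangentSpace I y}

lemma covDerivCurvature_swap (u : TangentSpace I x) :
    covDerivCurvature nabla x u X Y Z W = -covDerivCurvature nabla x u Y X Z W := by
  have e : (fun y ↦ curvature nabla y (X y) (Y y) (Z y) (W y))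
      = -fun y ↦ curvature nabla y (Y y) (X y) (Z y) (W y) :=
    funext fun y ↦ curvature_swap ..
  simp only [covDerivCurvature, e, mvfderiv_neg, neg_apply, curvature_swap (Y x),
    curvature_swap (nabla Y x u)]
  ring

lemma CurvaturePairSymmetric.swap_right (hR : CurvaturePairSymmetric nabla)
    (u v w z : TangentSpace I x) : curvature nabla x u v w z = -curvature nabla x u v z w := by
  rw [hR, curvature_swap, hR]

lemma CurvaturePairSymmetric.covDerivCurvature (hR : CurvaturePairSymmetric nabla)
    (u : TangentSpace I x) :
    covDerivCurvature nabla x u X Y Z W = covDerivCurvature nabla x u Z W X Y := by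
  have e : (fun y ↦ curvature nabla y (X y) (Y y) (Z y) (W y))
      = fun y ↦ curvature nabla y (Z y) (W y) (X y) (Y y) := funext fun y ↦ hR ..
  rw [SkewTorsion.covDerivCurvature, SkewTorsion.covDerivCurvature, e, hR x (nabla X x u),
    hR x (X x) (nabla Y x u), hR x (X x) (Y x) (nabla Z x u), hR x (X x) (Y x) (Z x)]
  ring

/-- `(∇_u R)(X, Y, Z, W) = (∇_u R)(Y, X, W, Z)`. -/
lemma CurvaturePairSymmetric.covDerivCurvature_swap_swap (hR : CurvaturePairSymmetric nabla)
    (u : TangentSpace I x) :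
    SkewTorsion.covDerivCurvature nabla x u X Y Z W
      = SkewTorsion.covDerivCurvature nabla x u Y X W Z := by
  rw [covDerivCurvature_swap, hR.covDerivCurvature, covDerivCurvature_swap, neg_neg,
    hR.covDerivCurvature]

variable [FiniteDimensional ℝ E]

lemma CurvaturePairSymmetric.ricci_comm (hR : CurvaturePairSymmetric nabla)
    (u v : TangentSpace I x) : ricci nabla x u v = ricci nabla x v u := by
  refine Finset.sum_congr rfl fun i _ ↦ ?_
  rw [hR, curvature_swap, hR.swap_right, neg_neg]

lemma HasSkewTorsion.cyclic (hT : HasSkewTorsion nabla) (u v w : TangentSpace I x) :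
    torsionForm nabla x v w u = torsionForm nabla x u v w := by
  rw [(hT x v w u).2, (hT x v u w).1, neg_neg]

/-- Puts the quadratic torsion terms of the first Bianchi identity in a form whose symmetries are
visible. -/
lemma HasSkewTorsion.torsionForm_torsion (hT : HasSkewTorsion nabla) (u v w z : TangentSpace I x) :
    torsionForm nabla x (nabla.torsion x u v) w z
      = inner ℝ (nabla.torsion x u v) (nabla.torsion x w z) := by
  rw [← hT.cyclic, real_inner_comm]; rfl

lemma HasSkewTorsion.covDerivTorsion (hT : HasSkewTorsion nabla) (u : TangentSpace I x) :
    covDerivTorsion nabla x u X Y Z = -covDerivTorsion nabla x u Y X Z ∧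
    covDerivTorsion nabla x u X Y Z = -covDerivTorsion nabla x u X Z Y := by
  have e1 : (fun y ↦ torsionForm nabla y (X y) (Y y) (Z y))
      = -fun y ↦ torsionForm nabla y (Y y) (X y) (Z y) := funext fun y ↦ (hT y _ _ _).1
  have e2 : (fun y ↦ torsionForm nabla y (X y) (Y y) (Z y))
      = -fun y ↦ torsionForm nabla y (X y) (Z y) (Y y) := funext fun y ↦ (hT y _ _ _).2
  constructor
  · rw [SkewTorsion.covDerivTorsion, SkewTorsion.covDerivTorsion, e1, mvfderiv_neg, neg_apply,
      (hT x (nabla X x u) _ _).1, (hT x (X x) (nabla Y x u) _).1, (hT x (X x) (Y x) _).1]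
    ring
  · rw [SkewTorsion.covDerivTorsion, SkewTorsion.covDerivTorsion, e2, mvfderiv_neg, neg_apply,
      (hT x (nabla X x u) _ _).2, (hT x (X x) (nabla Y x u) _).2, (hT x (X x) (Y x) _).2]
    ring

/-- Expand T(e_i, e_j) in the basis e_l: for fixed i, j the product T_ijk T_ijl is symmetric in k,
l, while T(e_l, e_k, u) is skew. -/
lemma sum_mul_torsionForm_torsion (hT : HasSkewTorsion nabla) (u : TangentSpace I x) :
    ∑ i, ∑ j, ∑ k, torsionForm nabla x (onb I x i) (onb I x j) (onb I x k)
      * torsionForm nabla x (nabla.torsion x (onb I x i) (onb I x j)) (onb I x k) u = 0 := by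
  refine Finset.sum_eq_zero fun i _ ↦ Finset.sum_eq_zero fun j _ ↦ ?_
  rw [← SkewTorsion.sum_mul_eq_zero_of_skew
    (s := fun k l ↦ torsionForm nabla x (onb I x i) (onb I x j) (onb I x k)
      * torsionForm nabla x (onb I x i) (onb I x j) (onb I x l))
    (a := fun k l ↦ torsionForm nabla x (onb I x l) (onb I x k) u)
    (fun k l ↦ mul_comm _ _) (fun k l ↦ (hT x _ _ _).1)]
  refine Finset.sum_congr rfl fun k _ ↦ ?_
  rw [(isLinearMap_torsionForm₁ (onb I x k) u).eq_sum_inner (onb I x), Finset.mul_sum]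
  refine Finset.sum_congr rfl fun l _ ↦ ?_
  rw [real_inner_comm]
  change _ * (torsionForm nabla x (onb I x i) (onb I x j) (onb I x l) * _) = _
  ring

variable [T2Space M] [IsContMDiffRiemannianBundle I ∞ E (fun x : M ↦ TangentSpace I x)]
  (hn : nabla.ContMDiffCovariantDerivative ∞) (hmetric : IsMetric nabla)
  (hT : HasSkewTorsion nabla) (hR : CurvaturePairSymmetric nabla)
include hn hmetric hT hR

/-- If the curvature is pair symmetric, then `∇T` is totally skew-symmetric. -/
lemma covDerivTorsion_skew (hX : SmoothNear x X) (hY : SmoothNear x Y) (hZ : SmoothNear x Z)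
    (hV : SmoothNear x V) :
    covDerivTorsion nabla x (X x) Y Z V = -covDerivTorsion nabla x (V x) Y Z X := by
  -- Add the first Bianchi identities for (X, Y, Z; V) and (V, Y, Z; X). All curvature and quadratic
  -- terms cancel, as do the derivatives along Y and Z; only those along X and V survive.
  have h1 := firstBianchi_torsionForm hn hmetric hX hY hZ hV
  have h2 := firstBianchi_torsionForm hn hmetric hV hY hZ hX
  simp only [hT.torsionForm_torsion] at h1 h2
  have r1 := hR.swap_right (Y x) (Z x) (X x) (V x)
  have r2 := hR x (Z x) (V x) (Y x) (X x)
  have r3 := curvature_swap (nabla := nabla) (Y x) (X x) (Z x) (V x)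
  have r4 := hR x (V x) (Y x) (Z x) (X x)
  have r5 := hR.swap_right (Z x) (X x) (Y x) (V x)
  have a1 := (hT.covDerivTorsion (X := Z) (Y := X) (Z := V) (Y x)).2
  have a2 := (hT.covDerivTorsion (X := X) (Y := Y) (Z := V) (Z x)).1
  have a3 := (hT.covDerivTorsion (X := Y) (Y := X) (Z := V) (Z x)).2
  have a4 := (hT.covDerivTorsion (X := Y) (Y := V) (Z := X) (Z x)).1
  have t1 : inner ℝ (nabla.torsion x (Z x) (V x)) (nabla.torsion x (Y x) (X x))
      = -inner ℝ (nabla.torsion x (X x) (Y x)) (nabla.torsion x (Z x) (V x)) := by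
    rw [nabla.torsion_antisymm (Y x), inner_neg_right, real_inner_comm]
  have t2 : inner ℝ (nabla.torsion x (Y x) (Z x)) (nabla.torsion x (V x) (X x))
      = -inner ℝ (nabla.torsion x (Y x) (Z x)) (nabla.torsion x (X x) (V x)) := by
    rw [nabla.torsion_antisymm (V x), inner_neg_right]
  have t3 : inner ℝ (nabla.torsion x (V x) (Y x)) (nabla.torsion x (Z x) (X x))
      = -inner ℝ (nabla.torsion x (Z x) (X x)) (nabla.torsion x (Y x) (V x)) := by
    rw [nabla.torsion_antisymm (V x), inner_neg_left, real_inner_comm]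
  linear_combination r1 + r2 + r3 + r4 + r5 - h1 - h2 - a1 - a2 + a3 - a4 - t1 - t2 - t3

/-- The contraction of the torsion with the curvature. -/
lemma OrthonormalFrameNear.sum_torsionForm_mul_curvature (hF : OrthonormalFrameNear x F)
    (hU : SmoothNear x U) :
    ∑ i, ∑ j, ∑ k, torsionForm nabla x (onb I x i) (onb I x j) (onb I x k)
        * curvature nabla x (onb I x i) (onb I x j) (onb I x k) (U x)
      = -∑ i, ∑ j, ∑ k, torsionForm nabla x (onb I x i) (onb I x j) (onb I x k)
        * covDerivTorsion nabla x (U x) (F i) (F j) (F k) := by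
  -- Cyclic invariance of T lets the indices of the other factor be rotated under the sum, so each
  -- cyclic sum below contributes three equal terms.
  have rot : ∀ f : TangentSpace I x → TangentSpace I x → TangentSpace I x → ℝ,
      ∑ i, ∑ j, ∑ k, torsionForm nabla x (onb I x i) (onb I x j) (onb I x k)
          * f (onb I x j) (onb I x k) (onb I x i)
        = ∑ i, ∑ j, ∑ k, torsionForm nabla x (onb I x i) (onb I x j) (onb I x k)
          * f (onb I x i) (onb I x j) (onb I x k) := by
    intro f
    rw [← Finset.sum_comm_cycle]
    refine Finset.sum_congr rfl fun i _ ↦ Finset.sum_congr rfl fun j _ ↦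
      Finset.sum_congr rfl fun k _ ↦ ?_
    rw [← hT.cyclic (onb I x k)]
  have rot' : ∀ f : TangentSpace I x → TangentSpace I x → TangentSpace I x → ℝ,
      ∑ i, ∑ j, ∑ k, torsionForm nabla x (onb I x i) (onb I x j) (onb I x k)
          * f (onb I x k) (onb I x i) (onb I x j)
        = ∑ i, ∑ j, ∑ k, torsionForm nabla x (onb I x i) (onb I x j) (onb I x k)
          * f (onb I x i) (onb I x j) (onb I x k) :=
    fun f ↦ (rot fun u v w ↦ f v w u).trans (rot f)
  -- Total skewness of ∇T turns each of the three derivative terms of the first Bianchi identity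
  -- into -(∇_U T)(e_i, e_j, e_k), whence the -3.
  have hB : ∀ i j k, curvature nabla x (onb I x i) (onb I x j) (onb I x k) (U x)
        + curvature nabla x (onb I x j) (onb I x k) (onb I x i) (U x)
        + curvature nabla x (onb I x k) (onb I x i) (onb I x j) (U x)
      = -3 * covDerivTorsion nabla x (U x) (F i) (F j) (F k)
        + torsionForm nabla x (nabla.torsion x (onb I x i) (onb I x j)) (onb I x k) (U x)
        + torsionForm nabla x (nabla.torsion x (onb I x j) (onb I x k)) (onb I x i) (U x)
        + torsionForm nabla x (nabla.torsion x (onb I x k) (onb I x i)) (onb I x j) (U x) := by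
    intro i j k
    have h := firstBianchi_torsionForm hn hmetric (hF.smooth i) (hF.smooth j) (hF.smooth k) hU
    have h1 := covDerivTorsion_skew hn hmetric hT hR (hF.smooth i) (hF.smooth j) (hF.smooth k) hU
    have h2 := covDerivTorsion_skew hn hmetric hT hR (hF.smooth j) (hF.smooth k) (hF.smooth i) hU
    have h3 := covDerivTorsion_skew hn hmetric hT hR (hF.smooth k) (hF.smooth i) (hF.smooth j) hU
    have c1 := (hT.covDerivTorsion (X := F j) (Y := F k) (Z := F i) (U x)).2
    have c2 := (hT.covDerivTorsion (X := F j) (Y := F i) (Z := F k) (U x)).1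
    have c3 := (hT.covDerivTorsion (X := F k) (Y := F i) (Z := F j) (U x)).1
    have c4 := (hT.covDerivTorsion (X := F i) (Y := F k) (Z := F j) (U x)).2
    simp only [hF.self] at h h1 h2 h3
    linear_combination h + h1 + h2 + h3 - c1 + c2 - c3 + c4
  have q := rot fun u v w ↦ curvature nabla x u v w (U x)
  have q' := rot' fun u v w ↦ curvature nabla x u v w (U x)
  have t := sum_mul_torsionForm_torsion hT (U x)
  have t' := rot fun u v w ↦ torsionForm nabla x (nabla.torsion x u v) w (U x)
  have t'' := rot' fun u v w ↦ torsionForm nabla x (nabla.torsion x u v) w (U x)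
  beta_reduce at q q' t' t''
  have h : ∑ i, ∑ j, ∑ k, torsionForm nabla x (onb I x i) (onb I x j) (onb I x k) *
        (curvature nabla x (onb I x i) (onb I x j) (onb I x k) (U x)
        + curvature nabla x (onb I x j) (onb I x k) (onb I x i) (U x)
        + curvature nabla x (onb I x k) (onb I x i) (onb I x j) (U x))
      = 3 * ∑ i, ∑ j, ∑ k, torsionForm nabla x (onb I x i) (onb I x j) (onb I x k)
        * curvature nabla x (onb I x i) (onb I x j) (onb I x k) (U x) := by
    simp only [mul_add, Finset.sum_add_distrib, q, q']
    ring
  simp only [hB, mul_add, Finset.sum_add_distrib, t', t'', t, mul_left_comm _ (-3 : ℝ),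
    ← Finset.mul_sum] at h
  linarith

/-- The contracted second Bianchi identity, with its defect. -/
lemma OrthonormalFrameNear.mvfderiv_scal_sub (hF : OrthonormalFrameNear x F)
    (u : TangentSpace I x) :
    mvfderiv I (SkewTorsion.scal nabla) x u
        - 2 * ∑ i,
          SkewTorsion.covDerivBilin nabla (SkewTorsion.ricci nabla) x (onb I x i) u (onb I x i)
      = -(1 / 2) * mvfderiv I (SkewTorsion.torsionNormSq nabla) x u := by
  have hU : SmoothNear x (ext u) := .ext u
  have hcov : ∀ i,
      SkewTorsion.covDerivBilin nabla (SkewTorsion.ricci nabla) x (onb I x i) u (onb I x i)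
      = ∑ j, covDerivCurvature nabla x (onb I x i) (F j) (ext u) (F i) (F j) := by
    intro i
    have := hF.covDerivBilin_ricci hn hmetric hU (hF.smooth i) (onb I x i)
    rwa [ext_self, hF.self] at this
  have hRic : ∑ i, ∑ j, torsionForm nabla x (onb I x i) u (onb I x j)
      * SkewTorsion.ricci nabla x (onb I x j) (onb I x i) = 0 :=
    sum_mul_eq_zero_of_skew (fun i j ↦ hR.ricci_comm _ _) fun i j ↦ by
      rw [(hT x _ _ _).1, hT.cyclic, hT.cyclic]
  have hRic' : ∀ v, ∑ i, SkewTorsion.ricci nabla x (nabla.torsion x (onb I x i) v) (onb I x i)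
      = ∑ i, ∑ j, torsionForm nabla x (onb I x i) v (onb I x j)
        * SkewTorsion.ricci nabla x (onb I x j) (onb I x i) := by
    intro v
    refine Finset.sum_congr rfl fun i _ ↦ ?_
    rw [(isLinearMap_ricci₁ hn (onb I x i)).eq_sum_inner (onb I x)]
    exact Finset.sum_congr rfl fun j _ ↦ by rw [real_inner_comm]; rfl
  have hQ := hF.sum_torsionForm_mul_curvature hn hmetric hT hR hU
  rw [ext_self] at hQ
  -- The second Bianchi identity on (e_i, u, e_j) with last slots (e_j, e_i), rearranged so that
  -- summing over i and j yields Ricci and scalar contractions.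
  have hB : ∀ i j, covDerivCurvature nabla x (onb I x i) (F j) (ext u) (F i) (F j)
      - covDerivCurvature nabla x u (F i) (F j) (F j) (F i)
      + covDerivCurvature nabla x (onb I x j) (F i) (ext u) (F j) (F i)
      + curvature nabla x (onb I x j) (nabla.torsion x (onb I x i) u) (onb I x i) (onb I x j)
      + curvature nabla x (onb I x i) (nabla.torsion x (onb I x j) u) (onb I x j) (onb I x i)
      + ∑ k, torsionForm nabla x (onb I x j) (onb I x i) (onb I x k)
        * curvature nabla x (onb I x j) (onb I x i) (onb I x k) u = 0 := by
    intro i j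
    have h := secondBianchi hn hmetric (hF.smooth i) hU (hF.smooth j) (hF.smooth j) (hF.smooth i)
    simp only [ext_self, hF.self] at h
    have d1 := hR.covDerivCurvature_swap_swap (X := ext u) (Y := F j) (Z := F j) (W := F i)
      (onb I x i)
    have d2 := covDerivCurvature_swap (nabla := nabla) (X := F j) (Y := F i) (Z := F j) (W := F i) u
    have r1 : curvature nabla x (nabla.torsion x (onb I x i) u) (onb I x j) (onb I x j) (onb I x i)
        = curvature nabla x (onb I x j) (nabla.torsion x (onb I x i) u) (onb I x i) (onb I x j) := by
      rw [curvature_swap, hR.swap_right, neg_neg]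
    have r2 : curvature nabla x (nabla.torsion x u (onb I x j)) (onb I x i) (onb I x j) (onb I x i)
        = curvature nabla x (onb I x i) (nabla.torsion x (onb I x j) u) (onb I x j)
          (onb I x i) := by
      rw [nabla.torsion_antisymm u, (isLinearMap_curvature₁ hn _ _ _).map_neg, curvature_swap,
        neg_neg]
    have r3 : curvature nabla x (nabla.torsion x (onb I x j) (onb I x i)) u (onb I x j) (onb I x i)
        = ∑ k, torsionForm nabla x (onb I x j) (onb I x i) (onb I x k)
          * curvature nabla x (onb I x j) (onb I x i) (onb I x k) u := by
      rw [(isLinearMap_curvature₁ hn _ _ _).eq_sum_inner (onb I x)]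
      exact Finset.sum_congr rfl fun k _ ↦ by rw [real_inner_comm, hR]; rfl
    linear_combination h - d1 - d2 - r1 - r2 - r3
  have hsum := Finset.sum_eq_zero fun j (_ : j ∈ Finset.univ) ↦
    Finset.sum_eq_zero fun i (_ : i ∈ Finset.univ) ↦ hB i j
  simp only [Finset.sum_add_distrib, Finset.sum_sub_distrib] at hsum
  rw [Finset.sum_comm, hQ, ← hF.mvfderiv_scal hn hmetric] at hsum
  have c1 := Finset.sum_comm (s := Finset.univ) (t := Finset.univ) (f := fun j i ↦
    curvature nabla x (onb I x j) (nabla.torsion x (onb I x i) u) (onb I x i) (onb I x j))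
  have c2 : ∀ v, ∑ i, ∑ j,
      curvature nabla x (onb I x j) (nabla.torsion x (onb I x i) v) (onb I x i) (onb I x j)
      = ∑ i, SkewTorsion.ricci nabla x (nabla.torsion x (onb I x i) v) (onb I x i) := fun v ↦ rfl
  rw [c1, c2, hRic', hRic] at hsum
  rw [hF.mvfderiv_torsionNormSq hn hmetric]
  simp only [hcov]
  linarith

end ContractedBianchi

/-! ### Functions with zero differential -/

section Constancy

variable {E : Type*} [NormedAddCommGroup E] [NormedSpace ℝ E]
  {H : Type*} [TopologicalSpace H] {I : ModelWithCorners ℝ E H} [I.Boundaryless]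
  {M : Type*} [TopologicalSpace M] [ChartedSpace H M] [IsManifold I 1 M]

/-- A function with vanishing differential on a manifold without boundary is locally constant. -/
lemma isLocallyConstant_of_mvfderiv_eq_zero {f : M → ℝ} (hf : MDiff f)
    (h : ∀ x, mvfderiv I f x = 0) : IsLocallyConstant f := by
  rw [IsLocallyConstant.iff_eventually_eq]
  intro x
  have hopen := isOpen_extChartAt_target (I := I) x
  have hd : ∀ z ∈ (extChartAt I x).target,
      HasFDerivAt (f ∘ (extChartAt I x).symm) (0 : E →L[ℝ] ℝ) z := by
    intro z hz
    have h0 : mfderiv I 𝓘(ℝ, ℝ) f ((extChartAt I x).symm z) = 0 := h _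
    have h1 := (hf ((extChartAt I x).symm z)).hasMFDerivAt
    rw [h0] at h1
    have h2 : MDiffAt (extChartAt I x).symm z := by
      have := mdifferentiableWithinAt_extChartAt_symm (I := I) hz
      rwa [I.range_eq_univ, mdifferentiableWithinAt_univ] at this
    simpa using! (h1.comp z h2.hasMFDerivAt).hasFDerivAt
  -- Without boundary the chart target is open in `E`, so a zero derivative there makes the level
  -- sets open.
  have key := hopen.isOpen_inter_preimage_of_fderiv_eq_zero
    (fun z hz ↦ (hd z hz).differentiableAt.differentiableWithinAt)
    (fun z hz ↦ (hd z hz).fderiv) {f x}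
  have hx : extChartAt I x x ∈ (extChartAt I x).target
      ∩ (f ∘ (extChartAt I x).symm) ⁻¹' {f x} := ⟨mem_extChartAt_target x, by simp⟩
  filter_upwards [continuousAt_extChartAt (I := I) x |>.preimage_mem_nhds (key.mem_nhds hx),
    extChartAt_source_mem_nhds (I := I) x] with y hy hys
  have h1 : f ((extChartAt I x).symm (extChartAt I x y)) = f x := hy.2
  rwa [(extChartAt I x).left_inv hys] at h1

end Constancy

/-! ### The Ricci flat case -/

section RicciFlat

variable {E : Type*} [NormedAddCommGroup E] [NormedSpace ℝ E] [FiniteDimensional ℝ E]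
  {H : Type*} [TopologicalSpace H] {I : ModelWithCorners ℝ E H}
  {M : Type*} [TopologicalSpace M] [ChartedSpace H M] [IsManifold I ∞ M]
  [RiemannianBundle (fun x : M ↦ TangentSpace I x)]
  {nabla : CovariantDerivative I E (TangentSpace I : M → Type _)}

lemma RicciFlat.contractedSecondBianchi (h : RicciFlat nabla) : ContractedSecondBianchi nabla := by
  intro x u
  have hs : scal nabla = fun _ ↦ 0 := funext fun y ↦ Finset.sum_eq_zero fun i _ ↦ h y _ _
  have hr : ricci nabla = fun _ _ _ ↦ 0 := funext fun y ↦ funext fun u ↦ funext fun v ↦ h y u v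
  simp [hs, hr, covDerivBilin, mvfderiv_const]

end RicciFlat

end SkewTorsion

end

/-! ### The main theorem -/

theorem mainTheorem5
    {E : Type*} [NormedAddCommGroup E] [NormedSpace ℝ E] [FiniteDimensional ℝ E]
    {H : Type*} [TopologicalSpace H] {I : ModelWithCorners ℝ E H} [I.Boundaryless]
    {M : Type*} [TopologicalSpace M] [T2Space M] [ConnectedSpace M]
    [ChartedSpace H M] [IsManifold I ∞ M]
    [RiemannianBundle (fun x : M ↦ TangentSpace I x)]
    [IsContMDiffRiemannianBundle I ∞ E (fun x : M ↦ TangentSpace I x)]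
    (nabla : CovariantDerivative I E (TangentSpace I : M → Type _))
    (hsmooth : nabla.ContMDiffCovariantDerivative ∞)
    (hmetric : SkewTorsion.IsMetric nabla)
    (hskew : SkewTorsion.HasSkewTorsion nabla)
    (hR : SkewTorsion.CurvaturePairSymmetric nabla) :
    (SkewTorsion.ContractedSecondBianchi nabla ↔
      ∃ c : ℝ, ∀ x : M, SkewTorsion.torsionNormSq nabla x = c) ∧
    (SkewTorsion.RicciFlat nabla →
      ∃ c : ℝ, ∀ x : M, SkewTorsion.torsionNormSq nabla x = c) := by
  have key : SkewTorsion.ContractedSecondBianchi nabla ↔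
      ∃ c : ℝ, ∀ x : M, SkewTorsion.torsionNormSq nabla x = c := by
    constructor
    · intro h
      have hd : ∀ x : M, mvfderiv I (SkewTorsion.torsionNormSq nabla) x = 0 := by
        intro x
        obtain ⟨F, hF⟩ := SkewTorsion.exists_orthonormalFrameNear I x
        ext u
        have := hF.mvfderiv_scal_sub hsmooth hmetric hskew hR u
        rw [h x u] at this
        simp only [zero_apply]
        linarith
      -- Connectedness of `M` enters here, turning locally constant into constant.
      obtain ⟨c, hc⟩ := (SkewTorsion.isLocallyConstant_of_mvfderiv_eq_zero
        (fun x ↦ (SkewTorsion.smoothFunNear_torsionNormSq hsmooth x).mdifferentiableAt)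
        hd).exists_eq_const
      exact ⟨c, fun x ↦ congrFun hc x⟩
    · rintro ⟨c, hc⟩ x u
      obtain ⟨F, hF⟩ := SkewTorsion.exists_orthonormalFrameNear I x
      rw [hF.mvfderiv_scal_sub hsmooth hmetric hskew hR u, funext hc, mvfderiv_const]
      simp
  exact ⟨key, fun h ↦ key.1 h.contractedSecondBianchi⟩
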